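/- **Setting.** Let $\mathcal H=\bigotimes_{a=1}^n\mathcal H_a$ with $\mathcal H_a=\mathbb C^{d_a}$ finite-dimensional, and let $\mathcal N_1,\dots,\mathcal N_K\subsetneq\{1,\dots,n\}$, $K\ge 1$, be given neighborhoods. For each $k$ write $\mathcal H=\mathcal H_{\mathcal N_k}\otimes\mathcal H_{\overline{\mathcal N}_k}$, with $\mathcal H_{\mathcal N_k}=\bigotimes_{a\in\mathcal N_k}\mathcal H_a$ and $\mathcal H_{\overline{\mathcal N}_k}=\bigotimes_{a\notin\mathcal N_k}\mathcal H_a$. A *neighborhood map* is a linear map $\mathcal E=\mathcal E_{\mathcal N_k}\otimes\mathcal I_{\overline{\mathcal N}_k}$ on $\mathcal B(\mathcal H)$, for some $k$, where $\mathcal E_{\mathcal N_k}$ is a completely positive trace-preserving (CPTP) map on $\mathcal B(\mathcal H_{\mathcal N_k})$ and $\mathcal I_{\overline{\mathcal N}_k}$ is the identity map of $\mathcal B(\mathcal H_{\overline{\mathcal N}_k})$. A density operator $\rho$ on $\mathcal H$ is *quasi-locally stabilizable (QLS) by discrete-time dynamics* if there is a sequence $(\mathcal E_t)_{t\ge 0}$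 of neighborhood maps whose propagators $\mathcal E_{t,s}=\mathcal E_{t-1}\circ\cdots\circ\mathcal E_s$ (with $\mathcal E_{s,s}$ the identity) satisfy $\mathcal E_{t,s}(\rho)=\rho$ for all $t\ge s\ge 0$, and $\lim_{t\to\infty}\mathcal E_{t,s}(\sigma)=\rho$ for every density operator $\sigma$ on $\mathcal H$ and every $s\ge 0$. Let $\rho$ be a density operator of full rank on $\mathcal H$. For each $k$ let $\rho_k=\operatorname{Tr}_{\overline{\mathcal N}_k}(\rho)$ be the reduced state, and let $\Sigma_k(\rho)=\operatorname{span}\{A_j\}\subseteq\mathcal B(\mathcal H_{\mathcal N_k})$ be the Schmidt span, where $\rho=\sum_j A_j\otimes B_j$ is an operator Schmidt decomposition of $\rho$ with respect to $\mathcal H_{\mathcal N_k}\otimes\mathcal H_{\overline{\mathcal N}_k}$ (the $A_j$ are nonzero and pairwise Hilbert–Schmidt orthogonal, and so are the $B_j$; the span does not depend on the decomposition). Let $\mathcal A_k\subseteq\mathcal B(\mathcal H_{\mathcal N_k})$ be the smallest complex linear subspace that contains $\Sigma_k(\rho)$ and is closed under the adjoint $X\mapsto X^\dagger$, under the $\rho_k$-distorted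 product $(X,Y)\mapsto X\rho_k^{-1}Y$, and under the map $\mathcal M_{\rho_k,1/2}(X)=\rho_k^{1/2}X\rho_k^{-1/2}$. Put $\mathcal F_k=\mathcal A_k\otimes\mathcal B(\mathcal H_{\overline{\mathcal N}_k})$. **Theorem (QLS full-rank states).** A full-rank density operator $\rho$ on $\mathcal H$ is QLS by discrete-time dynamics with respect to $\mathcal N_1,\dots,\mathcal N_K$ if and only if $$\operatorname{span}_{\mathbb C}(\rho)=\bigcap_{k=1}^K\mathcal F_k .$$ -/

import Mathlib

open Matrix Filter Topology
open scoped Kronecker ComplexOrder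

namespace QLS

/-! ### States and dynamics on a matrix algebra -/

section Dynamics

variable {α : Type*} [Fintype α] [DecidableEq α]

/-- Density matrices: positive-semidefinite matrices of trace one. -/
def IsDensity (ρ : Matrix α α ℂ) : Prop :=
  ρ.PosSemidef ∧ ρ.trace = 1

/-- Completely positive trace-preserving maps, through their operator-sum (Kraus) representation:
`E X = ∑ k, M k * X * (M k)ᴴ` with `∑ k, (M k)ᴴ * M k = 1`. -/
def IsCPTP (E : Matrix α α ℂ →ₗ[ℂ] Matrix α α ℂ) : Prop :=
  ∃ (m : ℕ) (M : Fin m → Matrix α α ℂ),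
    (∀ X, E X = ∑ k, M k * X * (M k)ᴴ) ∧ ∑ k, (M k)ᴴ * M k = 1

/-- The propagator `E_{t,s} = E_{t-1} ∘ ⋯ ∘ E_s` (arguments `s`, then `t`), with `E_{s,s} = id`.
Only its values for `s ≤ t` are meaningful; it is the identity for `t < s`. -/
def propagator (E : ℕ → Matrix α α ℂ →ₗ[ℂ] Matrix α α ℂ) (s : ℕ) :
    ℕ → Matrix α α ℂ →ₗ[ℂ] Matrix α α ℂ
  | 0 => LinearMap.id
  | t + 1 => if s ≤ t then E t ∘ₗ propagator E s t else LinearMap.id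

/-- Asymptotic stabilization of the state `ρ` by the time-dependent dynamics `E`: `ρ` is invariant
under all propagators and every state is attracted to `ρ`, from every initial time. (Convergence is
the entrywise one, that is, convergence in any matrix norm, for instance the trace norm.) -/
def Stabilizes (E : ℕ → Matrix α α ℂ →ₗ[ℂ] Matrix α α ℂ) (ρ : Matrix α α ℂ) : Prop :=
  (∀ s t, s ≤ t → propagator E s t ρ = ρ) ∧
    ∀ τ, IsDensity τ → ∀ s, Tendsto (fun t => propagator E s t τ) atTop (𝓝 ρ)

end Dynamics

/-! ### Distorted algebras and minimal fixed-point sets -/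

section Distorted

variable {α : Type*} [Fintype α] [DecidableEq α]

/-- The real power `σ ^ s` of a positive-definite matrix `σ`, by functional calculus. -/
noncomputable def matPow (σ : Matrix α α ℂ) (s : ℝ) : Matrix α α ℂ :=
  cfc (fun x : ℝ => x ^ s) σ

/-- The modular-type map `M_{σ,s}(X) = σ^s X σ^{-s}`. -/
noncomputable def modularMap (σ : Matrix α α ℂ) (s : ℝ) (X : Matrix α α ℂ) : Matrix α α ℂ :=
  matPow σ s * X * matPow σ (-s)

/-- A `†`-closed `σ`-distorted algebra: a linear space of matrices closed under the adjoint and under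
the modified product `X ×_σ Y = X σ⁻¹ Y`. -/
structure IsDistortedAlgebra (σ : Matrix α α ℂ) (A : Submodule ℂ (Matrix α α ℂ)) : Prop where
  mul_mem : ∀ X ∈ A, ∀ Y ∈ A, X * σ⁻¹ * Y ∈ A
  adjoint_mem : ∀ X ∈ A, Xᴴ ∈ A

/-- Invariance of a linear space of matrices under `M_{σ,1/2}`. -/
def IsModularInvariant (σ : Matrix α α ℂ) (A : Submodule ℂ (Matrix α α ℂ)) : Prop :=
  ∀ X ∈ A, modularMap σ (1 / 2) X ∈ A

/-- The `†`-closed `σ`-distorted algebras that are `M_{σ,1/2}`-invariant and contain `W`. -/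
def fixedPointCandidates (σ : Matrix α α ℂ) (W : Set (Matrix α α ℂ)) :
    Set (Submodule ℂ (Matrix α α ℂ)) :=
  {A | W ⊆ A ∧ IsDistortedAlgebra σ A ∧ IsModularInvariant σ A}

/-- The minimal fixed-point set generated by `σ` and `W`: the smallest `M_{σ,1/2}`-invariant
`†`-closed `σ`-distorted algebra that contains `W`. -/
noncomputable def minimalFixedPointSet (σ : Matrix α α ℂ) (W : Set (Matrix α α ℂ)) :
    Submodule ℂ (Matrix α α ℂ) :=
  sInf (fixedPointCandidates σ W)

theorem isLeast_minimalFixedPointSet (σ : Matrix α α ℂ) (W : Set (Matrix α α ℂ)) :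
    IsLeast (fixedPointCandidates σ W) (minimalFixedPointSet σ W) := by
  refine ⟨⟨?_, ⟨?_, ?_⟩, ?_⟩, fun A hA => sInf_le hA⟩
  · intro X hX
    exact (Submodule.mem_sInf).2 fun A hA => hA.1 hX
  · intro X hX Y hY
    exact (Submodule.mem_sInf).2 fun A hA =>
      hA.2.1.mul_mem X ((Submodule.mem_sInf).1 hX A hA) Y ((Submodule.mem_sInf).1 hY A hA)
  · intro X hX
    exact (Submodule.mem_sInf).2 fun A hA =>
      hA.2.1.adjoint_mem X ((Submodule.mem_sInf).1 hX A hA)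
  · intro X hX
    exact (Submodule.mem_sInf).2 fun A hA => hA.2.2 X ((Submodule.mem_sInf).1 hX A hA)

end Distorted

/-! ### Bipartite systems: partial trace and operator Schmidt span -/

section Bipartite

variable {α β : Type*} [Fintype α] [Fintype β]

/-- The partial trace over the second factor. -/
def partialTrace (X : Matrix (α × β) (α × β) ℂ) : Matrix α α ℂ :=
  Matrix.of fun a a' => ∑ b, X (a, b) (a', b)

/-- `X = ∑ j, P j ⊗ Q j` is an operator Schmidt decomposition: both families consist of nonzero
matrices that are pairwise orthogonal for the Hilbert-Schmidt inner product `Tr (Sᴴ T)`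
(the Schmidt coefficients are absorbed in the factors). -/
structure IsSchmidtDecomposition (X : Matrix (α × β) (α × β) ℂ) {r : ℕ}
    (P : Fin r → Matrix α α ℂ) (Q : Fin r → Matrix β β ℂ) : Prop where
  sum_eq : X = ∑ j, P j ⊗ₖ Q j
  left_ne_zero : ∀ j, P j ≠ 0
  right_ne_zero : ∀ j, Q j ≠ 0
  left_orthogonal : ∀ i j, i ≠ j → ((P i)ᴴ * P j).trace = 0
  right_orthogonal : ∀ i j, i ≠ j → ((Q i)ᴴ * Q j).trace = 0

/-- The (left) Schmidt span of `X`: the span of the left factors of its operator Schmidt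
decompositions. All of them have the same span, see `schmidtSpan_eq`. -/
def schmidtSpan (X : Matrix (α × β) (α × β) ℂ) : Submodule ℂ (Matrix α α ℂ) :=
  Submodule.span ℂ {T | ∃ (r : ℕ) (P : Fin r → Matrix α α ℂ) (Q : Fin r → Matrix β β ℂ),
    IsSchmidtDecomposition X P Q ∧ T ∈ Set.range P}

/-- The block of `X` at position `(b, b')` of the second factor. -/
def slice (X : Matrix (α × β) (α × β) ℂ) (p : β × β) : Matrix α α ℂ :=
  Matrix.of fun a a' => X (a, p.1) (a', p.2)

theorem IsSchmidtDecomposition.span_range_eq {X : Matrix (α × β) (α × β) ℂ} {r : ℕ}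
    {P : Fin r → Matrix α α ℂ} {Q : Fin r → Matrix β β ℂ} (h : IsSchmidtDecomposition X P Q) :
    Submodule.span ℂ (Set.range P) = Submodule.span ℂ (Set.range (slice X)) := by
  have hs : ∀ p, slice X p = ∑ j, Q j p.1 p.2 • P j := by
    intro p
    ext a a'
    simp [slice, h.sum_eq, Matrix.sum_apply, mul_comm]
  apply le_antisymm
  · rw [Submodule.span_le]
    rintro _ ⟨j, rfl⟩
    have hc : ((Q j)ᴴ * Q j).trace ≠ 0 := by
      rw [Ne, Matrix.trace_conjTranspose_mul_self_eq_zero_iff]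
      exact h.right_ne_zero j
    have key : ∑ p : β × β, (star (Q j p.1 p.2)) • slice X p = ((Q j)ᴴ * Q j).trace • P j := by
      have ht : ∀ i, ∑ p : β × β, star (Q j p.1 p.2) * Q i p.1 p.2 = ((Q j)ᴴ * Q i).trace := by
        intro i
        rw [Fintype.sum_prod_type, Finset.sum_comm]
        simp [Matrix.trace, Matrix.mul_apply]
      simp_rw [hs, Finset.smul_sum, smul_smul]
      rw [Finset.sum_comm]
      simp_rw [← Finset.sum_smul, ht]
      rw [Finset.sum_eq_single j]
      · intro i _ hij
        rw [h.right_orthogonal j i hij.symm, zero_smul]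
      · simp
    have : P j = (((Q j)ᴴ * Q j).trace)⁻¹ • ∑ p : β × β, (star (Q j p.1 p.2)) • slice X p := by
      rw [key, smul_smul, inv_mul_cancel₀ hc, one_smul]
    rw [this]
    exact Submodule.smul_mem _ _ (Submodule.sum_mem _ fun p _ =>
      Submodule.smul_mem _ _ (Submodule.subset_span ⟨p, rfl⟩))
  · rw [Submodule.span_le]
    rintro _ ⟨p, rfl⟩
    rw [hs]
    exact Submodule.sum_mem _ fun j _ => Submodule.smul_mem _ _ (Submodule.subset_span ⟨j, rfl⟩)

/-- Every bipartite operator has an operator Schmidt decomposition. -/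
theorem exists_isSchmidtDecomposition (X : Matrix (α × β) (α × β) ℂ) :
    ∃ (r : ℕ) (P : Fin r → Matrix α α ℂ) (Q : Fin r → Matrix β β ℂ),
      IsSchmidtDecomposition X P Q := by
  classical
  let R : Matrix (α × α) (β × β) ℂ := Matrix.of fun p q => X (p.1, q.1) (p.2, q.2)
  have hG : (R * Rᴴ).IsHermitian := Matrix.isHermitian_mul_conjTranspose_self R
  let U : Matrix (α × α) (α × α) ℂ := hG.eigenvectorUnitary
  let lam : α × α → ℝ := hG.eigenvalues
  have hUU : Uᴴ * U = 1 := Unitary.coe_star_mul_self hG.eigenvectorUnitary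
  have hUU' : U * Uᴴ = 1 := Unitary.coe_mul_star_self hG.eigenvectorUnitary
  have hspec : R * Rᴴ = U * Matrix.diagonal (fun i => (lam i : ℂ)) * Uᴴ := by
    have := hG.spectral_theorem
    rw [Unitary.conjStarAlgAut_apply] at this
    exact this
  have hB : (Uᴴ * R) * (Uᴴ * R)ᴴ = Matrix.diagonal (fun i => (lam i : ℂ)) := by
    calc (Uᴴ * R) * (Uᴴ * R)ᴴ = Uᴴ * (R * Rᴴ) * U := by
          simp [Matrix.conjTranspose_mul, Matrix.mul_assoc]
      _ = (Uᴴ * U) * Matrix.diagonal (fun i => (lam i : ℂ)) * (Uᴴ * U) := by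
          rw [hspec]; simp only [Matrix.mul_assoc]
      _ = _ := by simp [hUU]
  let P : α × α → Matrix α α ℂ := fun i => Matrix.of fun a a' => U (a, a') i
  let Q : α × α → Matrix β β ℂ := fun i => Matrix.of fun b b' => (Uᴴ * R) i (b, b')
  have hQ : ∀ i j, ((Q i)ᴴ * Q j).trace = Matrix.diagonal (fun i => (lam i : ℂ)) j i := by
    intro i j
    rw [← hB, Matrix.mul_apply, Fintype.sum_prod_type, Finset.sum_comm]
    simp only [Matrix.trace, Matrix.diag, Matrix.mul_apply (M := (Q i)ᴴ), Q,
      Matrix.conjTranspose_apply (M := Uᴴ * R), Matrix.conjTranspose_apply, Matrix.of_apply]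
    exact Finset.sum_congr rfl fun _ _ => Finset.sum_congr rfl fun _ _ => mul_comm _ _
  have hP : ∀ i j, ((P i)ᴴ * P j).trace = (1 : Matrix (α × α) (α × α) ℂ) i j := by
    intro i j
    rw [← hUU, Matrix.mul_apply, Fintype.sum_prod_type, Finset.sum_comm]
    simp [Matrix.trace, Matrix.mul_apply, P]
  have hQ0 : ∀ i, lam i = 0 → Q i = 0 := by
    intro i hi
    rw [← Matrix.trace_conjTranspose_mul_self_eq_zero_iff, hQ]
    simp [hi]
  have hX : X = ∑ i, P i ⊗ₖ Q i := by
    have hR : R = U * (Uᴴ * R) := by rw [← Matrix.mul_assoc, hUU', Matrix.one_mul]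
    ext ⟨a, b⟩ ⟨a', b'⟩
    have : R (a, a') (b, b') = (U * (Uᴴ * R)) (a, a') (b, b') := by rw [← hR]
    rw [Matrix.mul_apply] at this
    simpa [Matrix.sum_apply, P, Q, R] using this
  let e := Fintype.equivFin {i : α × α // lam i ≠ 0}
  refine ⟨_, fun j => P (e.symm j), fun j => Q (e.symm j), ?_, ?_, ?_, ?_, ?_⟩
  · rw [Equiv.sum_comp e.symm (fun i => P i.1 ⊗ₖ Q i.1), hX]
    have h0 : ∀ i, i ∉ Finset.univ.filter (fun i => lam i ≠ 0) → P i ⊗ₖ Q i = 0 := by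
      intro i hi
      rw [hQ0 i (by simpa using hi), Matrix.kronecker_zero]
    rw [← Finset.sum_subset (Finset.subset_univ (Finset.univ.filter fun i => lam i ≠ 0))
      fun i _ hi => h0 i hi]
    exact Finset.sum_subtype _ (by simp) _
  · intro j h0
    have := hP (e.symm j) (e.symm j)
    simp [h0] at this
  · intro j h0
    have := hQ (e.symm j) (e.symm j)
    rw [h0] at this
    simp at this
    exact (e.symm j).2 (by exact_mod_cast this.symm)
  · intro i j hij
    rw [hP]
    exact Matrix.one_apply_ne fun h => hij (e.symm.injective (Subtype.ext h))
  · intro i j hij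
    rw [hQ]
    exact Matrix.diagonal_apply_ne _ fun h => hij (e.symm.injective (Subtype.ext h)).symm

theorem schmidtSpan_eq {X : Matrix (α × β) (α × β) ℂ} {r : ℕ}
    {P : Fin r → Matrix α α ℂ} {Q : Fin r → Matrix β β ℂ} (h : IsSchmidtDecomposition X P Q) :
    schmidtSpan X = Submodule.span ℂ (Set.range P) := by
  apply le_antisymm
  · refine Submodule.span_le.2 ?_
    rintro T ⟨r', P', Q', h', hT⟩
    rw [h.span_range_eq, ← h'.span_range_eq]
    exact Submodule.subset_span hT
  · exact Submodule.span_mono fun T hT => ⟨r, P, Q, h, hT⟩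

end Bipartite

/-! ### Multipartite systems and neighborhoods

The `a`-th of `n` subsystems has dimension `d a` and Hilbert space with orthonormal basis
`Fin (d a)`; operators on the tensor product are matrices over the product basis `Config d`. -/

section Multipartite

variable {n : ℕ} (d : Fin n → ℕ) (N : Finset (Fin n))

/-- The product basis of the whole system. -/
abbrev Config : Type := ∀ a : Fin n, Fin (d a)

/-- The product basis of the subsystems in `N`. -/
abbrev NbhdConfig : Type := ∀ a : {a : Fin n // a ∈ N}, Fin (d a)

/-- The product basis of the subsystems outside `N`. -/
abbrev ComplConfig : Type := ∀ a : {a : Fin n // a ∉ N}, Fin (d a)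

/-- The factorization of the basis behind `H = H_N ⊗ H_{N̄}`. -/
abbrev splitConfig : Config d ≃ NbhdConfig d N × ComplConfig d N :=
  Equiv.piEquivPiSubtypeProd (fun a => a ∈ N) (fun a => Fin (d a))

/-- An operator on the whole system, viewed on `H_N ⊗ H_{N̄}`. -/
def asBipartite (X : Matrix (Config d) (Config d) ℂ) :
    Matrix (NbhdConfig d N × ComplConfig d N) (NbhdConfig d N × ComplConfig d N) ℂ :=
  X.submatrix (splitConfig d N).symm (splitConfig d N).symm

/-- The operator `Y ⊗ Z` on the whole system, for `Y` on `N` and `Z` on the complement. -/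
def nbhdTensor (Y : Matrix (NbhdConfig d N) (NbhdConfig d N) ℂ)
    (Z : Matrix (ComplConfig d N) (ComplConfig d N) ℂ) : Matrix (Config d) (Config d) ℂ :=
  (Y ⊗ₖ Z).submatrix (splitConfig d N) (splitConfig d N)

/-- CPTP neighborhood maps `E = E_N ⊗ id` for the neighborhood `N`, with `E_N` CPTP. -/
def IsNeighborhoodMap (E : Matrix (Config d) (Config d) ℂ →ₗ[ℂ] Matrix (Config d) (Config d) ℂ) :
    Prop :=
  ∃ EN : Matrix (NbhdConfig d N) (NbhdConfig d N) ℂ →ₗ[ℂ] Matrix (NbhdConfig d N) (NbhdConfig d N) ℂ,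
    IsCPTP EN ∧ ∀ Y Z, E (nbhdTensor d N Y Z) = nbhdTensor d N (EN Y) Z

/-- The reduced state `Tr_{N̄} ρ`. -/
def reducedState (ρ : Matrix (Config d) (Config d) ℂ) :
    Matrix (NbhdConfig d N) (NbhdConfig d N) ℂ :=
  partialTrace (asBipartite d N ρ)

/-- The minimal fixed-point set of the neighborhood `N` for the full-rank state `ρ`:
`F_{ρ_N}(Σ_N(ρ)) ⊗ B(H_{N̄})`. -/
noncomputable def nbhdFixedPointSet (ρ : Matrix (Config d) (Config d) ℂ) :
    Submodule ℂ (Matrix (Config d) (Config d) ℂ) :=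
  Submodule.span ℂ {T | ∃ Y ∈ minimalFixedPointSet (reducedState d N ρ)
      (schmidtSpan (asBipartite d N ρ) : Set (Matrix (NbhdConfig d N) (NbhdConfig d N) ℂ)),
    ∃ Z, T = nbhdTensor d N Y Z}

/-- Discrete-time quasi-local stabilizability of `ρ` with respect to the neighborhoods `N k`:
some sequence of CPTP neighborhood maps stabilizes `ρ`. -/
def IsQLS {K : ℕ} (N : Fin K → Finset (Fin n)) (ρ : Matrix (Config d) (Config d) ℂ) : Prop :=
  ∃ E : ℕ → Matrix (Config d) (Config d) ℂ →ₗ[ℂ] Matrix (Config d) (Config d) ℂ,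
    (∀ t, ∃ k, IsNeighborhoodMap d (N k) (E t)) ∧ Stabilizes E ρ

end Multipartite

end QLS

namespace QLS

/-! ### Conjugation by a positive-definite matrix, its eigenvectors and its square root. -/

section ModularEigen

variable {α : Type*} [Fintype α] [DecidableEq α]

/-! Both directions rest on the weight `Tr (Xᴴ σ⁻¹ X)`. A channel `E` with Kraus operators `M k` and
faithful invariant state `σ` does not increase it, and `sum_defect` writes the loss as a sum of
nonnegative terms, one for each Kraus operator. Equality therefore makes every defect vanish. For a
fixed point `X` this says that `σ⁻¹ X` commutes with every `(M k)ᴴ`, and the fixed points of `E`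
form a modular invariant distorted algebra (`fixedPoints_mem_fixedPointCandidates`).

Necessity. If a neighborhood map fixes `ρ`, its local channel fixes all blocks of `ρ`, hence the
Schmidt span and the reduced state, hence by minimality the whole minimal fixed-point set. An
element of the intersection is thus fixed by every map of a stabilizing sequence. Since the
propagators converge to `X ↦ Tr(X) ρ`, it is a multiple of `ρ`.

Sufficiency. A modular invariant distorted algebra `A` containing `σ` is exactly the fixed-point set
of some channel (`exists_krausMap_eq_self_iff_mem`): `σ⁻¹ A` is a self-adjoint algebra, its
commutant is spanned by eigenvectors of `X ↦ σ X σ⁻¹`, and suitably weighted eigenvectors serve as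
Kraus operators; the double commutant theorem recovers `A`. A multiple of the identity among the
Kraus operators makes the channel fix every matrix whose weight it preserves. Applying these
channels cyclically, a traceless matrix that keeps its weight over a full cycle is fixed by all of
them, so it lies in the span of `ρ` and vanishes. By compactness each cycle contracts traceless
matrices by a uniform factor, and convergence is geometric (`stabilizes_cyclic`). -/

theorem matPow_eq {σ : Matrix α α ℂ} (hσ : σ.IsHermitian) (s : ℝ) :
    matPow σ s = (hσ.eigenvectorUnitary : Matrix α α ℂ) *
      Matrix.diagonal (fun i => ((hσ.eigenvalues i ^ s : ℝ) : ℂ)) *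
      (hσ.eigenvectorUnitary : Matrix α α ℂ)ᴴ := by
  rw [matPow, hσ.cfc_eq, Matrix.IsHermitian.cfc, Unitary.conjStarAlgAut_apply]
  rfl

theorem eigenvectorUnitary_conjTranspose_mul {σ : Matrix α α ℂ} (hσ : σ.IsHermitian) :
    (hσ.eigenvectorUnitary : Matrix α α ℂ)ᴴ * (hσ.eigenvectorUnitary : Matrix α α ℂ) = 1 :=
  Unitary.coe_star_mul_self hσ.eigenvectorUnitary

theorem eigenvectorUnitary_mul_conjTranspose {σ : Matrix α α ℂ} (hσ : σ.IsHermitian) :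
    (hσ.eigenvectorUnitary : Matrix α α ℂ) * (hσ.eigenvectorUnitary : Matrix α α ℂ)ᴴ = 1 :=
  Unitary.coe_mul_star_self hσ.eigenvectorUnitary

theorem matPow_one {σ : Matrix α α ℂ} (hσ : σ.IsHermitian) : matPow σ 1 = σ := by
  rw [matPow]
  simp only [Real.rpow_one]
  exact cfc_id' ℝ σ hσ

theorem matPow_zero {σ : Matrix α α ℂ} (hσ : σ.IsHermitian) : matPow σ 0 = 1 := by
  rw [matPow]
  simp only [Real.rpow_zero]
  exact cfc_const_one ℝ σ hσ

theorem matPow_mul_matPow {σ : Matrix α α ℂ} (hσ : σ.PosDef) (s t : ℝ) :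
    matPow σ s * matPow σ t = matPow σ (s + t) := by
  set U := (hσ.1.eigenvectorUnitary : Matrix α α ℂ) with hU
  have hUU : Uᴴ * U = 1 := eigenvectorUnitary_conjTranspose_mul hσ.1
  rw [matPow_eq hσ.1, matPow_eq hσ.1, matPow_eq hσ.1, ← hU]
  have : ∀ D D' : Matrix α α ℂ, U * D * Uᴴ * (U * D' * Uᴴ) = U * (D * D') * Uᴴ := by
    intro D D'
    calc U * D * Uᴴ * (U * D' * Uᴴ) = U * D * (Uᴴ * U) * D' * Uᴴ := by
          simp only [Matrix.mul_assoc]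
      _ = _ := by rw [hUU, Matrix.mul_one]; simp only [Matrix.mul_assoc]
  rw [this, Matrix.diagonal_mul_diagonal]
  congr 4
  ext i
  rw [Real.rpow_add (hσ.eigenvalues_pos i)]
  push_cast
  rfl

theorem matPow_neg_one {σ : Matrix α α ℂ} (hσ : σ.PosDef) : matPow σ (-1) = σ⁻¹ := by
  symm
  apply Matrix.inv_eq_right_inv
  have := matPow_mul_matPow hσ 1 (-1)
  rwa [matPow_one hσ.1, add_neg_cancel, matPow_zero hσ.1] at this

/-- Passes from invariance under `M_{σ,1/2}` to invariance under conjugation by `σ`;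
`modularMap_half_mem` is the converse passage. -/
theorem modularMap_half_half {σ : Matrix α α ℂ} (hσ : σ.PosDef) (X : Matrix α α ℂ) :
    modularMap σ (1 / 2) (modularMap σ (1 / 2) X) = σ * X * σ⁻¹ := by
  have h1 : matPow σ (1 / 2) * matPow σ (1 / 2) = σ := by
    rw [matPow_mul_matPow hσ]; norm_num; exact matPow_one hσ.1
  have h2 : matPow σ (-(1 / 2)) * matPow σ (-(1 / 2)) = σ⁻¹ := by
    rw [matPow_mul_matPow hσ]; norm_num; exact matPow_neg_one hσ
  rw [modularMap, modularMap]
  calc _ = (matPow σ (1 / 2) * matPow σ (1 / 2)) * X *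
        (matPow σ (-(1 / 2)) * matPow σ (-(1 / 2))) := by simp only [Matrix.mul_assoc]
    _ = _ := by rw [h1, h2]

/-- Matrices that are covariant for `X ↦ σ X σ⁻¹` are covariant for its real powers. -/
theorem matPow_mul_eq_smul {σ : Matrix α α ℂ} (hσ : σ.PosDef) {X : Matrix α α ℂ} {μ : ℝ}
    (hμ : 0 < μ) (hX : σ * X = (μ : ℂ) • (X * σ)) (s : ℝ) :
    matPow σ s * X = ((μ ^ s : ℝ) : ℂ) • (X * matPow σ s) := by
  set U := (hσ.1.eigenvectorUnitary : Matrix α α ℂ) with hU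
  have hUU : Uᴴ * U = 1 := eigenvectorUnitary_conjTranspose_mul hσ.1
  have hUU' : U * Uᴴ = 1 := eigenvectorUnitary_mul_conjTranspose hσ.1
  set D : ℝ → Matrix α α ℂ :=
    fun s => Matrix.diagonal (fun i => ((hσ.1.eigenvalues i ^ s : ℝ) : ℂ)) with hD
  have hP : ∀ s, matPow σ s = U * D s * Uᴴ := matPow_eq hσ.1
  set Z := Uᴴ * X * U with hZ
  have hXZ : X = U * Z * Uᴴ := by
    calc X = (U * Uᴴ) * X * (U * Uᴴ) := by rw [hUU']; simp
      _ = _ := by simp only [hZ, Matrix.mul_assoc]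
  have key : ∀ s, D s * Z = Uᴴ * (matPow σ s * X) * U ∧ Z * D s = Uᴴ * (X * matPow σ s) * U := by
    intro s
    rw [hP]
    constructor
    · calc D s * Z = (Uᴴ * U) * D s * Uᴴ * X * U := by
            rw [hUU, hZ]; simp only [Matrix.mul_assoc, Matrix.one_mul]
        _ = _ := by simp only [Matrix.mul_assoc]
    · calc Z * D s = Uᴴ * X * U * D s * (Uᴴ * U) := by rw [hUU, hZ]; simp
        _ = _ := by simp only [Matrix.mul_assoc]
  have hZ1 : D 1 * Z = (μ : ℂ) • (Z * D 1) := by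
    rw [(key 1).1, (key 1).2, matPow_one hσ.1, hX]; simp
  -- In an eigenbasis of `σ`, a nonzero entry `Z i j` forces `λ_i = μ λ_j`, and this relation can be
  -- raised to the power `s`.
  have hZs : D s * Z = ((μ ^ s : ℝ) : ℂ) • (Z * D s) := by
    ext i j
    have := congrFun (congrFun hZ1 i) j
    simp only [hD, Matrix.diagonal_mul, Matrix.mul_diagonal, Matrix.smul_apply, smul_eq_mul,
      Real.rpow_one] at this ⊢
    by_cases h0 : Z i j = 0
    · simp [h0]
    · have h1 : (hσ.1.eigenvalues i : ℂ) = ((μ * hσ.1.eigenvalues j : ℝ) : ℂ) := by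
        apply mul_right_cancel₀ h0
        rw [this]; push_cast; ring
      have h2 : hσ.1.eigenvalues i = μ * hσ.1.eigenvalues j := by exact_mod_cast h1
      rw [h2, Real.mul_rpow hμ.le (hσ.eigenvalues_pos j).le]
      push_cast; ring
  have back : ∀ W : Matrix α α ℂ, U * (Uᴴ * W * U) * Uᴴ = W := by
    intro W
    calc _ = (U * Uᴴ) * W * (U * Uᴴ) := by simp only [Matrix.mul_assoc]
      _ = _ := by rw [hUU']; simp
  have h3 := congrArg (fun W => U * W * Uᴴ) hZs
  simp only [(key s).1, (key s).2, Matrix.mul_smul, Matrix.smul_mul, back] at h3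
  exact h3

omit [DecidableEq α] in
theorem trace_conjTranspose_mul_mul_pos {β : Type*} [Fintype β] {σ : Matrix α α ℂ}
    (hσ : σ.PosDef) {Y : Matrix α β ℂ} (hY : Y ≠ 0) : 0 < (Yᴴ * σ * Y).trace := by
  have hd : ∀ j, (Yᴴ * σ * Y) j j = star (fun i => Y i j) ⬝ᵥ σ *ᵥ (fun i => Y i j) := by
    intro j
    rw [Matrix.mul_assoc, Matrix.mul_apply]
    rfl
  obtain ⟨j, hj⟩ : ∃ j, (fun i => Y i j) ≠ 0 := by
    by_contra! h
    exact hY (Matrix.ext fun i j => congrFun (h j) i)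
  refine Finset.sum_pos' (fun j _ => ?_) ⟨j, Finset.mem_univ _, ?_⟩
  · rw [Matrix.diag_apply, hd]
    exact hσ.posSemidef.dotProduct_mulVec_nonneg _
  · rw [Matrix.diag_apply, hd]
    exact hσ.dotProduct_mulVec_pos hj

/-- The covariant elements of a subspace invariant under `X ↦ σ X σ⁻¹` span it. -/
theorem mem_span_modularEigen {σ : Matrix α α ℂ} (hσ : σ.PosDef)
    {p : Submodule ℂ (Matrix α α ℂ)} (hp : ∀ X ∈ p, σ * X * σ⁻¹ ∈ p) {X : Matrix α α ℂ}
    (hX : X ∈ p) :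
    X ∈ Submodule.span ℂ {Y | Y ∈ p ∧ ∃ μ : ℝ, 0 < μ ∧ σ * Y = (μ : ℂ) • (Y * σ)} := by
  have hdet : IsUnit σ.det := (Matrix.isUnit_iff_isUnit_det σ).1 hσ.isUnit
  let f : Module.End ℂ (Matrix α α ℂ) :=
    (LinearMap.mulRight ℂ σ⁻¹) ∘ₗ (LinearMap.mulLeft ℂ σ)
  have hf : ∀ Y, f Y = σ * Y * σ⁻¹ := fun Y => rfl
  have hcov : ∀ Y (μ : ℂ), f Y = μ • Y ↔ σ * Y = μ • (Y * σ) := by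
    intro Y μ
    rw [hf]
    constructor
    · intro h
      calc σ * Y = σ * Y * σ⁻¹ * σ := by rw [Matrix.nonsing_inv_mul_cancel_right _ _ hdet]
        _ = _ := by rw [h, Matrix.smul_mul]
    · intro h
      rw [h, Matrix.smul_mul, Matrix.mul_nonsing_inv_cancel_right _ _ hdet]
  set U := (hσ.1.eigenvectorUnitary : Matrix α α ℂ) with hU
  have hUU : Uᴴ * U = 1 := eigenvectorUnitary_conjTranspose_mul hσ.1
  have hUU' : U * Uᴴ = 1 := eigenvectorUnitary_mul_conjTranspose hσ.1
  set D : Matrix α α ℂ := Matrix.diagonal (fun i => (hσ.1.eigenvalues i : ℂ)) with hD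
  have hspec : σ = U * D * Uᴴ := by
    have := matPow_eq hσ.1 1
    rw [matPow_one hσ.1] at this
    simpa using this
  -- Conjugation by `σ` is diagonalizable: the matrix units of an eigenbasis of `σ` are
  -- eigenvectors, with eigenvalues `λ_i / λ_j`. An invariant subspace is then the sum of its
  -- intersections with the eigenspaces.
  have htop : ⨆ μ, f.genEigenspace μ 1 = ⊤ := by
    rw [eq_top_iff]
    rintro Y -
    have hY : Y = ∑ i, ∑ j, (Uᴴ * Y * U) i j • (U * Matrix.single i j 1 * Uᴴ) := by
      have : Uᴴ * Y * U = ∑ i, ∑ j, (Uᴴ * Y * U) i j • Matrix.single i j (1 : ℂ) := by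
        conv_lhs => rw [Matrix.matrix_eq_sum_single (Uᴴ * Y * U)]
        simp
      calc Y = (U * Uᴴ) * Y * (U * Uᴴ) := by rw [hUU']; simp
        _ = U * (Uᴴ * Y * U) * Uᴴ := by simp only [Matrix.mul_assoc]
        _ = _ := by
          conv_lhs => rw [this]
          simp only [Matrix.mul_sum, Matrix.sum_mul, Matrix.mul_smul, Matrix.smul_mul]
    rw [hY]
    refine Submodule.sum_mem _ fun i _ => Submodule.sum_mem _ fun j _ => Submodule.smul_mem _ _ ?_
    refine Submodule.mem_iSup_of_mem
      ((hσ.1.eigenvalues i / hσ.1.eigenvalues j : ℝ) : ℂ) ?_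
    change _ ∈ f.eigenspace _
    rw [Module.End.mem_eigenspace_iff, hcov]
    have h1 : σ * (U * Matrix.single i j 1 * Uᴴ) = U * (D * Matrix.single i j 1) * Uᴴ := by
      calc _ = U * D * (Uᴴ * U) * Matrix.single i j 1 * Uᴴ := by
            rw [hspec]; simp only [Matrix.mul_assoc]
        _ = _ := by rw [hUU]; simp only [Matrix.mul_assoc, Matrix.one_mul]
    have h2 : U * Matrix.single i j 1 * Uᴴ * σ = U * (Matrix.single i j 1 * D) * Uᴴ := by
      calc _ = U * Matrix.single i j 1 * (Uᴴ * U) * D * Uᴴ := by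
            rw [hspec]; simp only [Matrix.mul_assoc]
        _ = _ := by rw [hUU]; simp only [Matrix.mul_assoc, Matrix.one_mul]
    have h3 : D * Matrix.single i j 1 =
        ((hσ.1.eigenvalues i / hσ.1.eigenvalues j : ℝ) : ℂ) • (Matrix.single i j 1 * D) := by
      have hj : (hσ.1.eigenvalues j : ℂ) ≠ 0 := by exact_mod_cast (hσ.eigenvalues_pos j).ne'
      ext a b
      simp only [hD, Matrix.diagonal_mul, Matrix.mul_diagonal, Matrix.smul_apply, smul_eq_mul]
      by_cases hab : i = a ∧ j = b
      · obtain ⟨rfl, rfl⟩ := hab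
        push_cast
        field_simp
      · rw [Matrix.single_apply_of_ne _ _ _ _ _ hab]; simp
    rw [h1, h2, h3, Matrix.mul_smul, Matrix.smul_mul]
  rw [Submodule.eq_iSup_inf_genEigenspace 1 (f := f) (p := p) (fun Y hY => hp Y hY) htop] at hX
  refine (show (⨆ μ, p ⊓ f.genEigenspace μ 1) ≤ _ from iSup_le fun μ => ?_) hX
  rintro Y ⟨hYp, hY⟩
  have hY' : σ * Y = μ • (Y * σ) := (hcov Y μ).1 (Module.End.mem_eigenspace_iff.1 hY)
  by_cases h0 : Y = 0
  · rw [h0]; exact Submodule.zero_mem _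
  refine Submodule.subset_span ⟨hYp, ?_⟩
  -- Positivity of the eigenvalue comes from comparing two positive traces: `Tr (Yᴴ σ Y) = μ Tr (Y σ
  -- Yᴴ)`.
  have hl : 0 < (Yᴴ * σ * Y).trace := trace_conjTranspose_mul_mul_pos hσ h0
  have hr : 0 < (Y * σ * Yᴴ).trace := by
    simpa using trace_conjTranspose_mul_mul_pos hσ (Y := Yᴴ) (by simpa using h0)
  have he : (Yᴴ * σ * Y).trace = μ * (Y * σ * Yᴴ).trace := by
    rw [Matrix.mul_assoc, hY', Matrix.mul_smul, Matrix.trace_smul, smul_eq_mul,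
      Matrix.trace_mul_comm]
  have hμ : 0 < μ := by
    rw [he] at hl
    exact pos_of_mul_pos_left hl hr.le
  obtain ⟨hre, him⟩ := Complex.pos_iff.1 hμ
  refine ⟨μ.re, hre, ?_⟩
  rw [hY']
  congr 1
  exact Complex.ext rfl him.symm

/-- On an eigenvector of conjugation by `σ` with eigenvalue `μ > 0`, the half-power conjugation is
multiplication by `μ ^ (1/2)`, and such eigenvectors span the subspace. -/
theorem modularMap_half_mem {σ : Matrix α α ℂ} (hσ : σ.PosDef)
    {p : Submodule ℂ (Matrix α α ℂ)} (hp : ∀ X ∈ p, σ * X * σ⁻¹ ∈ p) {X : Matrix α α ℂ}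
    (hX : X ∈ p) : modularMap σ (1 / 2) X ∈ p := by
  refine Submodule.span_induction (p := fun X _ => modularMap σ (1 / 2) X ∈ p) ?_ ?_ ?_ ?_
    (mem_span_modularEigen hσ hp hX)
  · rintro Y ⟨hY, μ, hμ, h⟩
    rw [modularMap, matPow_mul_eq_smul hσ hμ h, Matrix.smul_mul, Matrix.mul_assoc,
      matPow_mul_matPow hσ, add_neg_cancel, matPow_zero hσ.1, Matrix.mul_one]
    exact Submodule.smul_mem _ _ hY
  · simp [modularMap]
  · intro Y Z _ _ hY hZ
    simpa only [modularMap, Matrix.mul_add, Matrix.add_mul] using Submodule.add_mem _ hY hZ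
  · intro c Y _ hY
    simpa only [modularMap, Matrix.mul_smul, Matrix.smul_mul] using Submodule.smul_mem _ c hY

end ModularEigen
-- Channels with a faithful invariant state and their fixed points.
section Kraus

variable {α ι : Type*} [Fintype α] [DecidableEq α] [Fintype ι]

/-- The completely positive map with Kraus operators `M`. -/
def krausMap (M : ι → Matrix α α ℂ) : Matrix α α ℂ →ₗ[ℂ] Matrix α α ℂ :=
  ∑ k, LinearMap.mulRight ℂ (M k)ᴴ ∘ₗ LinearMap.mulLeft ℂ (M k)

theorem krausMap_apply (M : ι → Matrix α α ℂ) (X : Matrix α α ℂ) :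
    krausMap M X = ∑ k, M k * X * (M k)ᴴ := by
  simp [krausMap, LinearMap.sum_apply]

theorem isCPTP_krausMap {M : ι → Matrix α α ℂ} (hM : ∑ k, (M k)ᴴ * M k = 1) :
    IsCPTP (krausMap M) := by
  let e := Fintype.equivFin ι
  refine ⟨_, fun k => M (e.symm k), fun X => ?_, ?_⟩
  · rw [krausMap_apply]
    exact (Equiv.sum_comp e.symm fun k => M k * X * (M k)ᴴ).symm
  · rw [← hM]
    exact Equiv.sum_comp e.symm fun k => (M k)ᴴ * M k

theorem IsCPTP.exists_krausMap {E : Matrix α α ℂ →ₗ[ℂ] Matrix α α ℂ} (h : IsCPTP E) :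
    ∃ (m : ℕ) (M : Fin m → Matrix α α ℂ), E = krausMap M ∧ ∑ k, (M k)ᴴ * M k = 1 := by
  obtain ⟨m, M, h1, h2⟩ := h
  exact ⟨m, M, LinearMap.ext fun X => by rw [h1, krausMap_apply], h2⟩

theorem krausMap_conjTranspose (M : ι → Matrix α α ℂ) (X : Matrix α α ℂ) :
    krausMap M Xᴴ = (krausMap M X)ᴴ := by
  simp [krausMap_apply, Matrix.conjTranspose_sum, Matrix.mul_assoc]

theorem trace_krausMap_mul (M : ι → Matrix α α ℂ) (X Y : Matrix α α ℂ) :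
    (krausMap M X * Y).trace = (X * ∑ k, (M k)ᴴ * Y * M k).trace := by
  rw [krausMap_apply, Matrix.sum_mul, Matrix.mul_sum, Matrix.trace_sum, Matrix.trace_sum]
  refine Finset.sum_congr rfl fun k _ => ?_
  rw [Matrix.mul_assoc, Matrix.mul_assoc, Matrix.trace_mul_comm]
  simp only [Matrix.mul_assoc]

theorem trace_krausMap {M : ι → Matrix α α ℂ} (hM : ∑ k, (M k)ᴴ * M k = 1) (X : Matrix α α ℂ) :
    (krausMap M X).trace = X.trace := by
  have := trace_krausMap_mul M X 1
  simpa [hM] using this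

/-- The defect operators measuring the failure of equality in the Schwarz inequality. -/
noncomputable def defect (σ : Matrix α α ℂ) (M : ι → Matrix α α ℂ) (X : Matrix α α ℂ) (k : ι) :
    Matrix α α ℂ :=
  σ⁻¹ * X * (M k)ᴴ - (M k)ᴴ * σ⁻¹ * krausMap M X

/-- Expanding the squares leaves four sums. Trace preservation evaluates the first, invariance of
`σ` the last, and the two cross terms each contribute minus the weight of the image, so one copy of
it survives with a minus sign. -/
theorem sum_defect {σ : Matrix α α ℂ} (hσ : σ.PosDef) {M : ι → Matrix α α ℂ}
    (hM : ∑ k, (M k)ᴴ * M k = 1) (hfix : krausMap M σ = σ) (X : Matrix α α ℂ) :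
    ∑ k, ((defect σ M X k)ᴴ * σ * defect σ M X k).trace =
      (Xᴴ * σ⁻¹ * X).trace - ((krausMap M X)ᴴ * σ⁻¹ * krausMap M X).trace := by
  have hdet : IsUnit σ.det := (Matrix.isUnit_iff_isUnit_det σ).1 hσ.isUnit
  have hinv : (σ⁻¹)ᴴ = σ⁻¹ := hσ.inv.1
  set Y := krausMap M X with hY
  have h1 : ∀ k, (defect σ M X k)ᴴ * σ * defect σ M X k =
      M k * (Xᴴ * σ⁻¹ * X) * (M k)ᴴ - M k * Xᴴ * (M k)ᴴ * (σ⁻¹ * Y)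
        - Yᴴ * σ⁻¹ * (M k * X * (M k)ᴴ) + Yᴴ * σ⁻¹ * (M k * σ * (M k)ᴴ) * (σ⁻¹ * Y) := by
    intro k
    have e : (defect σ M X k)ᴴ = M k * Xᴴ * σ⁻¹ - Yᴴ * σ⁻¹ * M k := by
      simp [defect, hinv, Matrix.mul_assoc, ← hY]
    rw [e, defect, ← hY]
    simp only [Matrix.sub_mul, Matrix.mul_sub]
    simp only [Matrix.mul_assoc, Matrix.mul_nonsing_inv_cancel_left _ _ hdet,
      Matrix.nonsing_inv_mul_cancel_left _ _ hdet]
    abel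
  rw [← Matrix.trace_sum]
  simp_rw [h1]
  rw [Finset.sum_add_distrib, Finset.sum_sub_distrib, Finset.sum_sub_distrib,
    ← krausMap_apply, ← Matrix.sum_mul, ← Matrix.mul_sum, ← Matrix.sum_mul, ← Matrix.mul_sum,
    ← krausMap_apply, ← krausMap_apply, ← krausMap_apply, hfix, krausMap_conjTranspose, ← hY]
  simp only [Matrix.trace_add, Matrix.trace_sub, trace_krausMap hM]
  rw [Matrix.nonsing_inv_mul_cancel_right _ _ hdet]
  simp only [Matrix.mul_assoc]
  ring

/-- The squared norm `Tr (Xᴴ σ⁻¹ X)`. -/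
noncomputable def weight (σ X : Matrix α α ℂ) : ℝ := (Xᴴ * σ⁻¹ * X).trace.re

theorem weight_pos {σ : Matrix α α ℂ} (hσ : σ.PosDef) {X : Matrix α α ℂ} (hX : X ≠ 0) :
    0 < weight σ X :=
  (Complex.pos_iff.1 (trace_conjTranspose_mul_mul_pos hσ.inv hX)).1

theorem weight_krausMap_le {σ : Matrix α α ℂ} (hσ : σ.PosDef) {M : ι → Matrix α α ℂ}
    (hM : ∑ k, (M k)ᴴ * M k = 1) (hfix : krausMap M σ = σ) (X : Matrix α α ℂ) :
    weight σ (krausMap M X) ≤ weight σ X := by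
  have h := congrArg Complex.re (sum_defect hσ hM hfix X)
  rw [Complex.re_sum, Complex.sub_re] at h
  have h0 : 0 ≤ ∑ k, ((defect σ M X k)ᴴ * σ * defect σ M X k).trace.re :=
    Finset.sum_nonneg fun k _ =>
      (Complex.nonneg_iff.1 (hσ.posSemidef.conjTranspose_mul_mul_same _).trace_nonneg).1
  rw [h] at h0
  exact sub_nonneg.1 h0

theorem defect_eq_zero {σ : Matrix α α ℂ} (hσ : σ.PosDef) {M : ι → Matrix α α ℂ}
    (hM : ∑ k, (M k)ᴴ * M k = 1) (hfix : krausMap M σ = σ) {X : Matrix α α ℂ}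
    (hX : weight σ X ≤ weight σ (krausMap M X)) (k : ι) : defect σ M X k = 0 := by
  have h := congrArg Complex.re (sum_defect hσ hM hfix X)
  rw [Complex.re_sum, Complex.sub_re] at h
  by_contra hk
  have : 0 < ∑ k, ((defect σ M X k)ᴴ * σ * defect σ M X k).trace.re :=
    Finset.sum_pos' (fun k _ =>
      (Complex.nonneg_iff.1 (hσ.posSemidef.conjTranspose_mul_mul_same _).trace_nonneg).1)
      ⟨k, Finset.mem_univ _, (Complex.pos_iff.1 (trace_conjTranspose_mul_mul_pos hσ hk)).1⟩
  rw [h] at this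
  exact absurd hX (not_le.2 (sub_pos.1 this))

/-- A fixed point loses no weight, so its defects vanish, which is the commutation. Conversely, with
`X = σ W`, the factor `W` slides to the right past `(M k)ᴴ` and leaves the image of `σ` times `W`.
-/
theorem krausMap_eq_self_iff {σ : Matrix α α ℂ} (hσ : σ.PosDef) {M : ι → Matrix α α ℂ}
    (hM : ∑ k, (M k)ᴴ * M k = 1) (hfix : krausMap M σ = σ) (X : Matrix α α ℂ) :
    krausMap M X = X ↔ ∀ k, Commute (σ⁻¹ * X) (M k)ᴴ := by
  have hdet : IsUnit σ.det := (Matrix.isUnit_iff_isUnit_det σ).1 hσ.isUnit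
  constructor
  · intro h k
    have := defect_eq_zero hσ hM hfix (X := X) (by rw [h]) k
    rw [defect, h, sub_eq_zero, Matrix.mul_assoc _ _ X] at this
    exact this
  · intro h
    have hXW : X = σ * (σ⁻¹ * X) := (Matrix.mul_nonsing_inv_cancel_left _ _ hdet).symm
    generalize σ⁻¹ * X = W at h hXW
    subst hXW
    conv_rhs => rw [← hfix]
    rw [krausMap_apply, krausMap_apply, Matrix.sum_mul]
    refine Finset.sum_congr rfl fun k _ => ?_
    have := (h k).eq
    simp only [Matrix.mul_assoc, this]

omit [Fintype ι] [DecidableEq α] in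
theorem commute_conjTranspose_iff {W V : Matrix α α ℂ} : Commute Wᴴ V ↔ Commute W Vᴴ := by
  have := commute_star_comm (x := W) (y := V)
  exact this

/-- The commutant of the Kraus operators of a channel with a faithful invariant state is
self-adjoint. -/
theorem commute_conjTranspose_of_commute {σ : Matrix α α ℂ} (hσ : σ.PosDef)
    {M : ι → Matrix α α ℂ} (hM : ∑ k, (M k)ᴴ * M k = 1) (hfix : krausMap M σ = σ)
    {W : Matrix α α ℂ} (hW : ∀ k, Commute W (M k)) (k : ι) : Commute W (M k)ᴴ := by
  -- The commutators `[Wᴴ, M k]` are to vanish. The sum of their `Dᴴ D` is the dual channel applied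
  -- to `W Wᴴ`, minus `W Wᴴ`; its trace against the invariant `σ` is zero, and `σ` is faithful.
  set D : ι → Matrix α α ℂ := fun k => Wᴴ * M k - M k * Wᴴ with hD
  have hWs : ∀ k, (M k)ᴴ * Wᴴ = Wᴴ * (M k)ᴴ := fun k => by
    rw [← Matrix.conjTranspose_mul, ← Matrix.conjTranspose_mul, (hW k).eq]
  have h1 : ∀ k, (D k)ᴴ * D k = (M k)ᴴ * (W * Wᴴ) * M k - (M k)ᴴ * M k * (W * Wᴴ)
      - W * Wᴴ * ((M k)ᴴ * M k) + W * ((M k)ᴴ * M k) * Wᴴ := by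
    intro k
    have e : (D k)ᴴ = (M k)ᴴ * W - W * (M k)ᴴ := by simp [hD]
    have e1 : (M k)ᴴ * W * (M k * Wᴴ) = (M k)ᴴ * M k * (W * Wᴴ) := by
      rw [Matrix.mul_assoc, ← Matrix.mul_assoc W, (hW k).eq]
      simp only [Matrix.mul_assoc]
    have e2 : W * (M k)ᴴ * (Wᴴ * M k) = W * Wᴴ * ((M k)ᴴ * M k) := by
      rw [Matrix.mul_assoc, ← Matrix.mul_assoc _ Wᴴ, hWs]
      simp only [Matrix.mul_assoc]
    rw [e, hD]
    simp only [Matrix.sub_mul, Matrix.mul_sub]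
    rw [e1, e2]
    simp only [Matrix.mul_assoc]
    abel
  have h2 : ∑ k, (D k * σ * (D k)ᴴ).trace = 0 := by
    have h3 : ∑ k, (D k)ᴴ * D k = ∑ k, (M k)ᴴ * (W * Wᴴ) * M k - W * Wᴴ := by
      simp_rw [h1]
      rw [Finset.sum_add_distrib, Finset.sum_sub_distrib, Finset.sum_sub_distrib,
        ← Matrix.sum_mul, ← Matrix.mul_sum, ← Matrix.sum_mul, ← Matrix.mul_sum, hM]
      simp
    calc ∑ k, (D k * σ * (D k)ᴴ).trace = (σ * ∑ k, (D k)ᴴ * D k).trace := by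
          rw [Matrix.mul_sum, Matrix.trace_sum]
          refine Finset.sum_congr rfl fun k _ => ?_
          rw [Matrix.mul_assoc, Matrix.trace_mul_comm, Matrix.mul_assoc]
      _ = 0 := by
          rw [h3, Matrix.mul_sub, Matrix.trace_sub, ← trace_krausMap_mul, hfix, sub_self]
  have h4 : D k = 0 := by
    by_contra hk
    have hpos : ∀ k, 0 ≤ (D k * σ * (D k)ᴴ).trace := fun k =>
      (hσ.posSemidef.mul_mul_conjTranspose_same _).trace_nonneg
    have h5 := (Finset.sum_eq_zero_iff_of_nonneg fun k _ => hpos k).1 h2 k (Finset.mem_univ _)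
    have h6 := trace_conjTranspose_mul_mul_pos hσ (Y := (D k)ᴴ) (by simpa using hk)
    rw [Matrix.conjTranspose_conjTranspose, h5] at h6
    exact lt_irrefl _ h6
  rw [← commute_conjTranspose_iff]
  exact sub_eq_zero.1 h4

/-- The fixed points of a channel. -/
def fixedPoints (E : Matrix α α ℂ →ₗ[ℂ] Matrix α α ℂ) : Submodule ℂ (Matrix α α ℂ) :=
  LinearMap.eqLocus E LinearMap.id

omit [Fintype α] [DecidableEq α] in
theorem mem_fixedPoints {E : Matrix α α ℂ →ₗ[ℂ] Matrix α α ℂ} {X : Matrix α α ℂ} :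
    X ∈ fixedPoints E ↔ E X = X := Iff.rfl

/-- The fixed points of a channel with a faithful invariant state form a modular invariant
distorted algebra. -/
theorem fixedPoints_mem_fixedPointCandidates {σ : Matrix α α ℂ} (hσ : σ.PosDef)
    {E : Matrix α α ℂ →ₗ[ℂ] Matrix α α ℂ} (hE : IsCPTP E) (hfix : E σ = σ)
    {W : Set (Matrix α α ℂ)} (hW : ∀ X ∈ W, E X = X) :
    fixedPoints E ∈ fixedPointCandidates σ W := by
  obtain ⟨m, M, rfl, hM⟩ := hE.exists_krausMap
  have hdet : IsUnit σ.det := (Matrix.isUnit_iff_isUnit_det σ).1 hσ.isUnit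
  have hinv : (σ⁻¹)ᴴ = σ⁻¹ := hσ.inv.1
  have hadj : ∀ X ∈ fixedPoints (krausMap M), Xᴴ ∈ fixedPoints (krausMap M) := by
    intro X hX
    rw [mem_fixedPoints] at hX ⊢
    rw [krausMap_conjTranspose, hX]
  refine ⟨hW, ⟨fun X hX Y hY => ?_, hadj⟩, fun X hX => modularMap_half_mem hσ ?_ hX⟩
  · rw [mem_fixedPoints, krausMap_eq_self_iff hσ hM hfix] at hX hY ⊢
    intro k
    have := (hX k).mul_left (hY k)
    simpa only [Matrix.mul_assoc] using this
  -- Since `Xᴴ` is fixed too, `X σ⁻¹` commutes with each `M k`, hence also with `(M k)ᴴ`; and `X σ⁻¹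
  -- = σ⁻¹ (σ X σ⁻¹)`, which is the fixed-point criterion for `σ X σ⁻¹`.
  · intro X hX
    have hX' := hadj X hX
    rw [mem_fixedPoints, krausMap_eq_self_iff hσ hM hfix] at hX' ⊢
    have h1 : ∀ k, Commute (X * σ⁻¹) (M k) := fun k => by
      have := hX' k
      rw [← commute_conjTranspose_iff] at this
      simpa [hinv] using this
    intro k
    have := commute_conjTranspose_of_commute hσ hM hfix h1 k
    rwa [Matrix.mul_assoc, Matrix.nonsing_inv_mul_cancel_left _ _ hdet]

end Kraus

/-! ### The double commutant theorem in matrix algebras. -/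

section Commutant

variable {α : Type*} [Fintype α] [DecidableEq α]

/-- The double commutant theorem for self-adjoint matrix algebras. -/
theorem mem_of_commute_commutant {A : Submodule ℂ (Matrix α α ℂ)} (hone : 1 ∈ A)
    (hmul : ∀ X ∈ A, ∀ Y ∈ A, X * Y ∈ A) (hstar : ∀ X ∈ A, Xᴴ ∈ A) {T : Matrix α α ℂ}
    (hT : ∀ V, (∀ X ∈ A, Commute X V) → Commute T V) : T ∈ A := by
  let B : LinearMap.BilinForm ℂ (Matrix α α ℂ) :=
    (LinearMap.mul ℂ (Matrix α α ℂ)).compr₂ (Matrix.traceLinearMap α ℂ ℂ)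
  have hB : ∀ X Y, B X Y = (X * Y).trace := fun X Y => rfl
  have hrefl : B.IsRefl := fun X Y h => by
    rw [hB] at h ⊢
    rw [Matrix.trace_mul_comm, h]
  have hcompl : IsCompl A (B.orthogonal A) := by
    -- The trace form is nondegenerate on `A` because `A` contains adjoints: an `X` in `A`
    -- orthogonal to `A` has `Tr (Xᴴ X) = 0`.
    refine LinearMap.BilinForm.isCompl_orthogonal_of_restrict_nondegenerate hrefl
      (B.nondegenerate_restrict_of_disjoint_orthogonal hrefl ?_)
    rw [Submodule.disjoint_def]
    intro X hX hX'
    rw [← Matrix.trace_conjTranspose_mul_self_eq_zero_iff]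
    exact hX' _ (hstar X hX)
  let P : Matrix α α ℂ →ₗ[ℂ] Matrix α α ℂ := A.projection (B.orthogonal A) hcompl
  have hP1 : ∀ X, P X ∈ A := Submodule.projection_apply_mem hcompl
  have hPA : ∀ X ∈ A, P X = X := fun X hX =>
    Submodule.projection_apply_left hcompl ⟨X, hX⟩
  have hPmul : ∀ a ∈ A, ∀ X, P (a * X) = a * P X := by
    intro a ha X
    have hX : X - P X ∈ B.orthogonal A := by
      rw [← Submodule.ker_projection hcompl, LinearMap.mem_ker, map_sub]
      exact sub_eq_zero.2 (hPA _ (hP1 X)).symm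
    have haX : a * (X - P X) ∈ B.orthogonal A := by
      intro c hc
      have := hX (c * a) (hmul c hc a ha)
      change B c (a * (X - P X)) = 0
      rwa [hB, Matrix.mul_assoc] at this
    rw [← Submodule.ker_projection hcompl, LinearMap.mem_ker, Matrix.mul_sub, map_sub,
      sub_eq_zero] at haX
    exact haX.trans (hPA _ (hmul a ha _ (hP1 X)))
  -- The coefficients of `P`, regrouped so that `P` is assembled from left multiplications by the `b
  -- j k`. Left `A`-linearity of `P` puts every `b j k` in the commutant of `A`.
  obtain ⟨b, hb⟩ : ∃ b : α → α → Matrix α α ℂ, ∀ j k i l, b j k i l = P (Matrix.single l j 1) i k :=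
    ⟨fun j k => Matrix.of fun i l => P (Matrix.single l j 1) i k, fun _ _ _ _ => rfl⟩
  have hPb : ∀ X i k, P X i k = ∑ j, (b j k * X) i j := by
    intro X i k
    conv_lhs => rw [Matrix.matrix_eq_sum_single X]
    simp only [map_sum, Matrix.sum_apply, Matrix.mul_apply]
    rw [Finset.sum_comm]
    refine Finset.sum_congr rfl fun j _ => Finset.sum_congr rfl fun l _ => ?_
    have : Matrix.single l j (X l j) = X l j • Matrix.single l j (1 : ℂ) := by simp
    rw [this, map_smul, Matrix.smul_apply, smul_eq_mul, mul_comm, hb]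
  have hbA : ∀ j k, ∀ a ∈ A, Commute a (b j k) := by
    intro j k a ha
    ext i l
    have h1 : (a * b j k) i l = (a * P (Matrix.single l j 1)) i k := by
      simp [Matrix.mul_apply, hb]
    rw [h1, ← hPmul a ha, hPb]
    simp only [← Matrix.mul_assoc]
    rw [Finset.sum_eq_single j]
    · rw [Matrix.mul_single_apply_same, mul_one]
    · intro j' _ hj'
      rw [Matrix.mul_single_apply_of_ne _ _ _ _ _ hj']
    · simp
  -- `T` commutes with the `b j k`, so it can be pulled out on the left: `P T = T * P 1 = T`.
  have hPT : P T = T := by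
    have h1 := hPA 1 hone
    ext i k
    rw [hPb]
    have h2 : ∀ i, ∑ j, b j k i j = (1 : Matrix α α ℂ) i k := by
      intro i
      rw [← h1, hPb]; simp
    calc ∑ j, (b j k * T) i j = ∑ j, ∑ m, T i m * b j k m j :=
          Finset.sum_congr rfl fun j _ => by rw [← (hT _ (hbA j k)).eq, Matrix.mul_apply]
      _ = ∑ m, T i m * (1 : Matrix α α ℂ) m k := by
          rw [Finset.sum_comm]
          exact Finset.sum_congr rfl fun m _ => by rw [← Finset.mul_sum, h2]
      _ = T i k := by rw [← Matrix.mul_apply, Matrix.mul_one]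
  rw [← hPT]
  exact hP1 T

end Commutant
-- A channel with a prescribed fixed-point algebra.
section Construction

/-- Some Hermitian `K` satisfies `K² = 1/2 - c G` with `c > 0`, and `K` commutes with
everything that commutes with `G`. -/
theorem exists_sq_eq_half_sub_smul {α : Type*} [Fintype α] [DecidableEq α] {G : Matrix α α ℂ}
    (hG : G.IsHermitian) :
    ∃ (c : ℝ) (K : Matrix α α ℂ), 0 < c ∧ K.IsHermitian ∧
      K * K = (1 / 2 : ℂ) • (1 : Matrix α α ℂ) - (c : ℂ) • G ∧
      ∀ X, Commute G X → Commute K X := by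
  obtain ⟨b, hb⟩ : ∃ b : ℝ, ∀ x ∈ spectrum ℝ G, x ≤ b := by
    have : (spectrum ℝ G).Finite := by
      rw [hG.spectrum_real_eq_range_eigenvalues]
      exact Set.finite_range _
    obtain ⟨b, hb⟩ := this.bddAbove
    exact ⟨b, fun x hx => hb hx⟩
  -- Small enough that `c x ≤ 1/2` on the spectrum of `G`, so that `1/2 - c G` has a square root.
  set c : ℝ := 1 / (2 * (|b| + 1)) with hc
  have hb1 : 0 < |b| + 1 := by positivity
  have hc0 : 0 < c := by positivity
  have hle : ∀ x ∈ spectrum ℝ G, 0 ≤ 1 / 2 - c * x := by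
    intro x hx
    have h1 : x ≤ |b| + 1 := (hb x hx).trans ((le_abs_self b).trans (by linarith))
    have h2 : c * x ≤ c * (|b| + 1) := by gcongr
    have h3 : c * (|b| + 1) = 1 / 2 := by rw [hc]; field_simp
    linarith
  have hsa : IsSelfAdjoint G := hG
  have hcont : Continuous fun x : ℝ => Real.sqrt (1 / 2 - c * x) := by fun_prop
  refine ⟨c, cfc (fun x : ℝ => Real.sqrt (1 / 2 - c * x)) G, hc0,
    (cfc_predicate (fun x : ℝ => Real.sqrt (1 / 2 - c * x)) G : IsSelfAdjoint _), ?_,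
    fun X hX => hX.cfc_real _⟩
  rw [← cfc_mul _ _ G hcont.continuousOn hcont.continuousOn,
    cfc_congr (g := fun x : ℝ => 1 / 2 - c * x) fun x hx => Real.mul_self_sqrt (hle x hx),
    cfc_sub _ _ G (by fun_prop) (by fun_prop), cfc_const _ G hsa, cfc_const_mul _ _ G (by fun_prop),
    cfc_id' ℝ G hsa, Algebra.algebraMap_eq_smul_one]
  ext i j
  simp

variable {α : Type*} [Fintype α] [DecidableEq α]

/-- A modular invariant distorted algebra containing `σ` is the set of fixed points of a channel
with Kraus operators including a multiple of the identity. -/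
theorem exists_krausMap_eq_self_iff_mem {σ : Matrix α α ℂ} (hσ : σ.PosDef)
    {A : Submodule ℂ (Matrix α α ℂ)} (hA : IsDistortedAlgebra σ A) (hmod : IsModularInvariant σ A)
    (hσA : σ ∈ A) :
    ∃ (m : ℕ) (M : Fin m → Matrix α α ℂ), ∑ k, (M k)ᴴ * M k = 1 ∧
      (∃ k, ∃ c : ℂ, c ≠ 0 ∧ M k = c • 1) ∧ ∀ X, krausMap M X = X ↔ X ∈ A := by
  have hdet : IsUnit σ.det := (Matrix.isUnit_iff_isUnit_det σ).1 hσ.isUnit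
  have hinv : (σ⁻¹)ᴴ = σ⁻¹ := hσ.inv.1
  have hAmod : ∀ X ∈ A, σ * X * σ⁻¹ ∈ A := fun X hX => by
    rw [← modularMap_half_half hσ]
    exact hmod _ (hmod _ hX)
  -- the associated algebra `σ⁻¹ A`
  let R : Submodule ℂ (Matrix α α ℂ) := A.comap (LinearMap.mulLeft ℂ σ)
  have hR : ∀ X, X ∈ R ↔ σ * X ∈ A := fun X => Iff.rfl
  have hRone : 1 ∈ R := by rw [hR, Matrix.mul_one]; exact hσA
  have hRmul : ∀ X ∈ R, ∀ Y ∈ R, X * Y ∈ R := by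
    intro X hX Y hY
    have := hA.mul_mem _ hX _ hY
    simp only [LinearMap.mulLeft_apply] at this
    rwa [Matrix.mul_assoc, Matrix.nonsing_inv_mul_cancel_left _ _ hdet, Matrix.mul_assoc] at this
  -- Modular invariance is what makes `σ⁻¹ A` self-adjoint: `σ Xᴴ` is the conjugate by `σ` of `(σ
  -- X)ᴴ`.
  have hRstar : ∀ X ∈ R, Xᴴ ∈ R := by
    intro X hX
    rw [hR]
    have := hAmod _ (hA.adjoint_mem _ hX)
    simp only [LinearMap.mulLeft_apply, Matrix.conjTranspose_mul] at this
    rwa [hσ.1.eq, Matrix.mul_assoc, Matrix.mul_nonsing_inv_cancel_right _ _ hdet] at this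
  have hRmod : ∀ X ∈ R, σ * X * σ⁻¹ ∈ R := by
    intro X hX
    rw [hR]
    have := hAmod _ hX
    simpa only [LinearMap.mulLeft_apply, Matrix.mul_assoc] using this
  -- its commutant
  let C : Submodule ℂ (Matrix α α ℂ) :=
    { carrier := {V | ∀ X ∈ R, Commute X V}
      add_mem' := fun hV hW X hX => (hV X hX).add_right (hW X hX)
      zero_mem' := fun X _ => Commute.zero_right X
      smul_mem' := fun c V hV X hX => (hV X hX).smul_right c }
  have hC : ∀ V, V ∈ C ↔ ∀ X ∈ R, Commute X V := fun V => Iff.rfl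
  have hCstar : ∀ V ∈ C, Vᴴ ∈ C := by
    intro V hV X hX
    exact commute_conjTranspose_iff.1 (hV _ (hRstar X hX))
  have hCmod : ∀ V ∈ C, σ * V * σ⁻¹ ∈ C := by
    intro V hV X hX
    have h1 : σ⁻¹ * X * σ ∈ R := by
      have := hRstar _ (hRmod _ (hRstar _ hX))
      simpa [hσ.1.eq, hinv, Matrix.mul_assoc] using this
    have h2 := (hV _ h1).eq
    calc X * (σ * V * σ⁻¹) = σ * (σ⁻¹ * X * σ * V) * σ⁻¹ := by
          simp only [Matrix.mul_assoc, Matrix.mul_nonsing_inv_cancel_left _ _ hdet]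
      _ = σ * V * σ⁻¹ * X := by
          rw [h2]
          simp only [Matrix.mul_assoc, Matrix.mul_nonsing_inv _ hdet, Matrix.mul_one]
  -- a finite covariant spanning family of the commutant
  obtain ⟨T, hTsub, hTspan⟩ := Submodule.fg_span_iff_fg_span_finset_subset _ |>.1
    (IsNoetherian.noetherian (Submodule.span ℂ
      {Y | Y ∈ C ∧ ∃ μ : ℝ, 0 < μ ∧ σ * Y = (μ : ℂ) • (Y * σ)}))
  have hTC : ∀ V : T, (V : Matrix α α ℂ) ∈ C := fun V => (hTsub V.2).1
  choose μ hμ hcov using fun V : T => (hTsub V.2).2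
  have hcov1 : ∀ V : T, (V : Matrix α α ℂ) * σ = ((μ V)⁻¹ : ℂ) • (σ * V) := fun V => by
    rw [hcov, smul_smul, inv_mul_cancel₀ (by exact_mod_cast (hμ V).ne'), one_smul]
  have hcov2 : ∀ V : T, (V : Matrix α α ℂ)ᴴ * σ = (μ V : ℂ) • (σ * (V : Matrix α α ℂ)ᴴ) :=
    fun V => by
      have := congrArg conjTranspose (hcov V)
      simpa [hσ.1.eq] using this
  have hcov3 : ∀ V : T, σ * (V : Matrix α α ℂ)ᴴ = ((μ V)⁻¹ : ℂ) • ((V : Matrix α α ℂ)ᴴ * σ) :=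
    fun V => by
      rw [hcov2, smul_smul, inv_mul_cancel₀ (by exact_mod_cast (hμ V).ne'), one_smul]
  -- The Kraus operators will be `√c V` and `√(c/μ) Vᴴ`, so `c (G1 + G2)` is their contribution to
  -- trace preservation. The weight `1/μ` balances the action on `σ`: `c V σ Vᴴ = σ (c/μ) V Vᴴ` and
  -- `(c/μ) Vᴴ σ V = σ c Vᴴ V`, so the image of `σ` is `σ c (G1 + G2)`.
  set G1 : Matrix α α ℂ := ∑ V : T, (V : Matrix α α ℂ)ᴴ * V with hG1
  set G2 : Matrix α α ℂ := ∑ V : T, ((μ V)⁻¹ : ℂ) • ((V : Matrix α α ℂ) * (V : Matrix α α ℂ)ᴴ)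
    with hG2
  have hGH : (G1 + G2).IsHermitian := by
    simp [Matrix.IsHermitian, hG1, hG2, Matrix.conjTranspose_sum]
  obtain ⟨c, K, hc, hKH, hKK, hKcomm⟩ := exists_sq_eq_half_sub_smul hGH
  have hKC : K ∈ C := by
    intro X hX
    refine (hKcomm X (Commute.symm ?_)).symm
    refine Commute.add_right (Commute.sum_right _ _ _ fun V _ => ?_)
      (Commute.sum_right _ _ _ fun V _ => Commute.smul_right ?_ _)
    · exact (hCstar _ (hTC V) X hX).mul_right (hTC V X hX)
    · exact (hTC V X hX).mul_right (hCstar _ (hTC V) X hX)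
  have hKσ : Commute K σ := by
    refine hKcomm σ (Commute.symm ?_)
    refine Commute.add_right (Commute.sum_right _ _ _ fun V _ => ?_)
      (Commute.sum_right _ _ _ fun V _ => Commute.smul_right ?_ _)
    · change σ * (_ * _) = _ * _ * σ
      rw [← Matrix.mul_assoc, hcov3, Matrix.smul_mul, Matrix.mul_assoc, hcov, Matrix.mul_smul,
        smul_smul, inv_mul_cancel₀ (by exact_mod_cast (hμ V).ne'), one_smul, Matrix.mul_assoc]
    · change σ * (_ * _) = _ * _ * σ
      rw [← Matrix.mul_assoc, hcov, Matrix.smul_mul, Matrix.mul_assoc, hcov3, Matrix.mul_smul,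
        smul_smul, mul_inv_cancel₀ (by exact_mod_cast (hμ V).ne'), one_smul, Matrix.mul_assoc]
  have hcs : ((Real.sqrt c : ℝ) : ℂ) * (Real.sqrt c : ℝ) = c := by
    exact_mod_cast Real.mul_self_sqrt hc.le
  have hcm : ∀ V : T, ((Real.sqrt (c * (μ V)⁻¹) : ℝ) : ℂ) * (Real.sqrt (c * (μ V)⁻¹) : ℝ) =
      c * (μ V : ℂ)⁻¹ := fun V => by
    have := Real.mul_self_sqrt (mul_pos hc (inv_pos.2 (hμ V))).le
    exact_mod_cast this
  have hch : ((Real.sqrt (1 / 2) : ℝ) : ℂ) * (Real.sqrt (1 / 2) : ℝ) = 1 / 2 := by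
    have := Real.mul_self_sqrt (show (0 : ℝ) ≤ 1 / 2 by norm_num)
    rw [← Complex.ofReal_mul, this]; norm_num
  have hsc1 : ∀ (r : ℝ) (X : Matrix α α ℂ), ((r : ℂ) • X)ᴴ * ((r : ℂ) • X) =
      ((r : ℂ) * r) • (Xᴴ * X) := fun r X => by
    simp only [Matrix.conjTranspose_smul, Matrix.smul_mul, Matrix.mul_smul, smul_smul,
      Complex.star_def, Complex.conj_ofReal]
  have hsc2 : ∀ (r : ℝ) (X : Matrix α α ℂ), ((r : ℂ) • X) * σ * ((r : ℂ) • X)ᴴ =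
      ((r : ℂ) * r) • (X * σ * Xᴴ) := fun r X => by
    simp only [Matrix.conjTranspose_smul, Matrix.smul_mul, Matrix.mul_smul, smul_smul,
      Complex.star_def, Complex.conj_ofReal]
  -- `K` supplies the missing `1/2 - c (G1 + G2)` and commutes with `σ`; `√(1/2) • 1` supplies the
  -- other half and is the scalar Kraus operator required.
  let L : (T ⊕ T) ⊕ Bool → Matrix α α ℂ := Sum.elim
    (Sum.elim (fun V => ((Real.sqrt c : ℝ) : ℂ) • (V : Matrix α α ℂ))
      (fun V => ((Real.sqrt (c * (μ V)⁻¹) : ℝ) : ℂ) • (V : Matrix α α ℂ)ᴴ))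
    (fun i => if i then K else ((Real.sqrt (1 / 2) : ℝ) : ℂ) • 1)
  have hLC : ∀ k, L k ∈ C := by
    rintro ((V | V) | _ | _)
    · exact C.smul_mem _ (hTC V)
    · exact C.smul_mem _ (hCstar _ (hTC V))
    · exact C.smul_mem _ fun X _ => Commute.one_right X
    · exact hKC
  have hL1 : ∑ k, (L k)ᴴ * L k = 1 := by
    have e1 : ∀ V : T, (((Real.sqrt c : ℝ) : ℂ) • (V : Matrix α α ℂ))ᴴ *
        (((Real.sqrt c : ℝ) : ℂ) • (V : Matrix α α ℂ)) =
        (c : ℂ) • ((V : Matrix α α ℂ)ᴴ * V) := fun V => by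
      rw [hsc1, hcs]
    have e2 : ∀ V : T, (((Real.sqrt (c * (μ V)⁻¹) : ℝ) : ℂ) • (V : Matrix α α ℂ)ᴴ)ᴴ *
        (((Real.sqrt (c * (μ V)⁻¹) : ℝ) : ℂ) • (V : Matrix α α ℂ)ᴴ) =
        (c : ℂ) • ((μ V)⁻¹ : ℂ) • ((V : Matrix α α ℂ) * (V : Matrix α α ℂ)ᴴ) := fun V => by
      rw [hsc1, hcm, smul_smul, Matrix.conjTranspose_conjTranspose]
    simp only [L, Fintype.sum_sum_type, Sum.elim_inl, Sum.elim_inr, e1, e2, ← Finset.smul_sum,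
      ← hG1, ← hG2, Fintype.sum_bool, if_true, Bool.false_eq_true, if_false, hKH.eq, hKK]
    have e3 : (((Real.sqrt (1 / 2) : ℝ) : ℂ) • (1 : Matrix α α ℂ))ᴴ *
        (((Real.sqrt (1 / 2) : ℝ) : ℂ) • (1 : Matrix α α ℂ)) = (1 / 2 : ℂ) • 1 := by
      rw [hsc1, hch, Matrix.conjTranspose_one, Matrix.mul_one]
    rw [e3, smul_add]
    have : (1 : Matrix α α ℂ) = (1 / 2 : ℂ) • 1 + (1 / 2 : ℂ) • 1 := by
      rw [← add_smul]; norm_num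
    conv_rhs => rw [this]
    abel
  have hL2 : krausMap L σ = σ := by
    have e1 : ∀ V : T, (((Real.sqrt c : ℝ) : ℂ) • (V : Matrix α α ℂ)) * σ *
        (((Real.sqrt c : ℝ) : ℂ) • (V : Matrix α α ℂ))ᴴ =
        (c : ℂ) • σ * (((μ V)⁻¹ : ℂ) • ((V : Matrix α α ℂ) * (V : Matrix α α ℂ)ᴴ)) := fun V => by
      rw [hsc2, hcs, hcov1]
      simp only [Matrix.smul_mul, Matrix.mul_smul, Matrix.mul_assoc]
      rw [smul_comm]
    have e2 : ∀ V : T, (((Real.sqrt (c * (μ V)⁻¹) : ℝ) : ℂ) • (V : Matrix α α ℂ)ᴴ) * σ *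
        (((Real.sqrt (c * (μ V)⁻¹) : ℝ) : ℂ) • (V : Matrix α α ℂ)ᴴ)ᴴ =
        (c : ℂ) • σ * ((V : Matrix α α ℂ)ᴴ * V) := fun V => by
      have hμV : (μ V : ℂ) ≠ 0 := by exact_mod_cast (hμ V).ne'
      rw [hsc2, hcm, hcov2]
      simp only [Matrix.conjTranspose_conjTranspose, Matrix.smul_mul, smul_smul, Matrix.mul_assoc,
        inv_mul_cancel_right₀ hμV]
    have e3 : (((Real.sqrt (1 / 2) : ℝ) : ℂ) • (1 : Matrix α α ℂ)) * σ *
        (((Real.sqrt (1 / 2) : ℝ) : ℂ) • (1 : Matrix α α ℂ))ᴴ = (1 / 2 : ℂ) • σ := by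
      rw [hsc2, hch, Matrix.conjTranspose_one, Matrix.mul_one, Matrix.one_mul]
    have e4 : K * σ * Kᴴ = σ * ((1 / 2 : ℂ) • 1 - (c : ℂ) • (G1 + G2)) := by
      rw [hKH.eq, hKσ.eq, Matrix.mul_assoc, hKK]
    rw [krausMap_apply]
    simp only [L, Fintype.sum_sum_type, Sum.elim_inl, Sum.elim_inr, e1, e2, ← Matrix.mul_sum,
      ← hG1, ← hG2, Fintype.sum_bool, if_true, Bool.false_eq_true, if_false]
    rw [e3, e4]
    have : σ = (1 / 2 : ℂ) • σ + (1 / 2 : ℂ) • σ := by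
      rw [← add_smul]; norm_num
    conv_rhs => rw [this]
    simp only [Matrix.mul_sub, Matrix.mul_smul, Matrix.smul_mul, Matrix.mul_one, Matrix.mul_add,
      smul_add]
    abel
  have hLfix : ∀ X, krausMap L X = X ↔ X ∈ A := by
    intro X
    rw [krausMap_eq_self_iff hσ hL1 hL2]
    have hX : X ∈ A ↔ σ⁻¹ * X ∈ R := by
      rw [hR, Matrix.mul_nonsing_inv_cancel_left _ _ hdet]
    rw [hX]
    constructor
    · intro h
      -- The adjoints of the second family of Kraus operators are multiples of the `V`, which span
      -- the commutant of `R`; commuting with them therefore suffices for the double commutant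
      -- theorem.
      refine mem_of_commute_commutant hRone hRmul hRstar fun V hV => ?_
      have hVspan := mem_span_modularEigen hσ hCmod ((hC V).2 hV)
      rw [hTspan] at hVspan
      refine Submodule.span_induction (p := fun V _ => Commute (σ⁻¹ * X) V) ?_ ?_ ?_ ?_ hVspan
      · intro V hVT
        have h1 := h (Sum.inl (Sum.inr ⟨V, hVT⟩))
        simp only [L, Sum.elim_inl, Sum.elim_inr, Matrix.conjTranspose_smul,
          Matrix.conjTranspose_conjTranspose] at h1
        refine (Commute.smul_right_iff₀ ?_).1 h1
        have h2 := Real.sqrt_pos.2 (mul_pos hc (inv_pos.2 (hμ ⟨V, hVT⟩)))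
        simpa using h2.ne'
      · exact Commute.zero_right _
      · exact fun _ _ _ _ => Commute.add_right
      · exact fun c _ _ h => h.smul_right c
    · exact fun h k => hCstar _ (hLC k) _ h
  let e := Fintype.equivFin ((T ⊕ T) ⊕ Bool)
  refine ⟨_, fun k => L (e.symm k), ?_,
    ⟨e (Sum.inr false), ((Real.sqrt (1 / 2) : ℝ) : ℂ), ?_, ?_⟩, fun X => ?_⟩
  · rw [← hL1]
    exact Equiv.sum_comp e.symm fun k => (L k)ᴴ * L k
  · simp
  · simp [L]
  · rw [← hLfix X, krausMap_apply, krausMap_apply,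
      Equiv.sum_comp e.symm fun k => L k * X * (L k)ᴴ]

end Construction
-- Strict contraction in the weight and convergence of cyclic dynamics.
section Convergence

variable {α : Type*} [Fintype α] [DecidableEq α]

theorem weight_zero (σ : Matrix α α ℂ) : weight σ 0 = 0 := by simp [weight]

theorem weight_nonneg {σ : Matrix α α ℂ} (hσ : σ.PosDef) (X : Matrix α α ℂ) : 0 ≤ weight σ X := by
  by_cases h : X = 0
  · rw [h, weight_zero]
  · exact (weight_pos hσ h).le

theorem weight_real_smul (σ : Matrix α α ℂ) (r : ℝ) (X : Matrix α α ℂ) :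
    weight σ ((r : ℂ) • X) = r ^ 2 * weight σ X := by
  simp only [weight, Matrix.conjTranspose_smul, Matrix.smul_mul, Matrix.mul_smul,
    Matrix.trace_smul, Complex.star_def, Complex.conj_ofReal, smul_eq_mul, Complex.re_ofReal_mul]
  ring

theorem continuous_weight (σ : Matrix α α ℂ) : Continuous (weight σ) := by
  unfold weight
  fun_prop

open scoped Matrix.Norms.Elementwise in
/-- A linear map that strictly decreases the weight on a subspace is a strict contraction there. -/
theorem exists_lt_one_weight_le {σ : Matrix α α ℂ} (hσ : σ.PosDef)
    {S : Submodule ℂ (Matrix α α ℂ)} {T : Matrix α α ℂ →ₗ[ℂ] Matrix α α ℂ}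
    (hT : ∀ X ∈ S, X ≠ 0 → weight σ (T X) < weight σ X) :
    ∃ c : ℝ, 0 ≤ c ∧ c < 1 ∧ ∀ X ∈ S, weight σ (T X) ≤ c * weight σ X := by
  have : ProperSpace (Matrix α α ℂ) := FiniteDimensional.proper ℂ _
  have hcT : Continuous T := T.continuous_of_finiteDimensional
  have hcomp : IsCompact (Metric.sphere (0 : Matrix α α ℂ) 1 ∩ S) :=
    (isCompact_sphere _ _).inter_right S.closed_of_finiteDimensional
  have hne : ∀ X ∈ Metric.sphere (0 : Matrix α α ℂ) 1 ∩ S, X ≠ 0 := by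
    rintro X ⟨hX, -⟩ rfl
    simp at hX
  have hf : ContinuousOn (fun X => weight σ (T X) / weight σ X)
      (Metric.sphere (0 : Matrix α α ℂ) 1 ∩ S) :=
    ((continuous_weight σ).comp hcT).continuousOn.div (continuous_weight σ).continuousOn
      fun X hX => (weight_pos hσ (hne X hX)).ne'
  have hscale : ∀ X ∈ S, X ≠ 0 →
      (((‖X‖⁻¹ : ℝ) : ℂ) • X) ∈ Metric.sphere (0 : Matrix α α ℂ) 1 ∩ S := by
    intro X hX h0
    refine ⟨?_, S.smul_mem _ hX⟩
    rw [mem_sphere_zero_iff_norm, norm_smul]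
    simp [h0]
  rcases (Metric.sphere (0 : Matrix α α ℂ) 1 ∩ (S : Set (Matrix α α ℂ))).eq_empty_or_nonempty
    with he | hn
  -- An empty unit sphere means that the subspace is zero, so any factor works.
  · refine ⟨0, le_rfl, one_pos, fun X hX => ?_⟩
    by_cases h0 : X = 0
    · simp [h0, weight_zero]
    · have := hscale X hX h0
      rw [he] at this
      exact this.elim
  · obtain ⟨X₀, hX₀, hmax⟩ := hcomp.exists_isMaxOn hn hf
    have hp := weight_pos hσ (hne X₀ hX₀)
    refine ⟨_, div_nonneg (weight_nonneg hσ (T X₀)) hp.le,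
      (div_lt_one hp).2 (hT X₀ hX₀.2 (hne X₀ hX₀)), fun X hX => ?_⟩
    by_cases h0 : X = 0
    · simp [h0, weight_zero]
    · have h1 := hmax (hscale X hX h0)
      have hn0 : (‖X‖⁻¹ : ℝ) ^ 2 ≠ 0 := by simp [h0]
      simp only [Set.mem_ofPred_eq, map_smul, weight_real_smul] at h1
      rw [mul_div_mul_left _ _ hn0] at h1
      exact (div_le_iff₀ (weight_pos hσ h0)).1 h1

-- By compactness the weight has a positive lower bound `b` on the unit sphere; scaling gives `b
-- ‖X‖² ≤ weight σ X`.
open scoped Matrix.Norms.Elementwise in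
theorem tendsto_zero_of_weight {σ : Matrix α α ℂ} (hσ : σ.PosDef) {Y : ℕ → Matrix α α ℂ}
    (hY : Tendsto (fun m => weight σ (Y m)) atTop (𝓝 0)) : Tendsto Y atTop (𝓝 0) := by
  have : ProperSpace (Matrix α α ℂ) := FiniteDimensional.proper ℂ _
  have hcomp : IsCompact (Metric.sphere (0 : Matrix α α ℂ) 1) := isCompact_sphere _ _
  obtain ⟨b, hb, hle⟩ : ∃ b : ℝ, 0 < b ∧ ∀ X ∈ Metric.sphere (0 : Matrix α α ℂ) 1,
      b ≤ weight σ X := by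
    rcases (Metric.sphere (0 : Matrix α α ℂ) 1).eq_empty_or_nonempty with he | hn
    · exact ⟨1, one_pos, by simp [he]⟩
    · obtain ⟨X₀, hX₀, hmin⟩ := hcomp.exists_isMinOn hn (continuous_weight σ).continuousOn
      refine ⟨_, weight_pos hσ (X := X₀) ?_, fun X hX => hmin hX⟩
      rintro rfl
      simp at hX₀
  have hbound : ∀ X, b * ‖X‖ ^ 2 ≤ weight σ X := by
    intro X
    by_cases h0 : X = 0
    · simp [h0, weight_zero]
    · have h1 := hle (((‖X‖⁻¹ : ℝ) : ℂ) • X) (by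
        rw [mem_sphere_zero_iff_norm, norm_smul]; simp [h0])
      rw [weight_real_smul, inv_pow, inv_mul_eq_div, le_div_iff₀ (by positivity)] at h1
      exact h1
  refine tendsto_zero_iff_norm_tendsto_zero.2 ?_
  have h2 : Tendsto (fun m => Real.sqrt (weight σ (Y m) / b)) atTop (𝓝 0) := by
    have := (hY.div_const b).sqrt
    simpa using this
  refine squeeze_zero (fun m => norm_nonneg _) (fun m => ?_) h2
  apply Real.le_sqrt_of_sq_le
  rw [le_div_iff₀ hb, mul_comm]
  exact hbound _

omit [Fintype α] [DecidableEq α] in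
theorem propagator_self (E : ℕ → Matrix α α ℂ →ₗ[ℂ] Matrix α α ℂ) (s : ℕ) :
    propagator E s s = LinearMap.id := by
  cases s <;> simp [propagator]

omit [Fintype α] [DecidableEq α] in
theorem propagator_add_succ (E : ℕ → Matrix α α ℂ →ₗ[ℂ] Matrix α α ℂ) (s m : ℕ) :
    propagator E s (s + (m + 1)) = E (s + m) ∘ₗ propagator E s (s + m) := by
  rw [← add_assoc, propagator, if_pos (Nat.le_add_right s m)]

omit [Fintype α] [DecidableEq α] in
theorem propagator_apply_eq_self {E : ℕ → Matrix α α ℂ →ₗ[ℂ] Matrix α α ℂ} {X : Matrix α α ℂ}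
    (h : ∀ t, E t X = X) (s m : ℕ) : propagator E s (s + m) X = X := by
  induction m with
  | zero => rw [add_zero, propagator_self]; rfl
  | succ m ih => rw [propagator_add_succ, LinearMap.comp_apply, ih, h]

omit [Fintype α] [DecidableEq α] in
theorem propagator_add (E : ℕ → Matrix α α ℂ →ₗ[ℂ] Matrix α α ℂ) (s K m : ℕ) :
    propagator E s (s + (K + m)) =
      propagator E (s + K) (s + K + m) ∘ₗ propagator E s (s + K) := by
  induction m with
  | zero => rw [add_zero, add_zero, propagator_self]; rfl
  | succ m ih =>
    rw [← add_assoc K, propagator_add_succ, ih, propagator_add_succ, LinearMap.comp_assoc,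
      add_assoc s]

omit [Fintype α] [DecidableEq α] in
theorem propagator_shift {E : ℕ → Matrix α α ℂ →ₗ[ℂ] Matrix α α ℂ} {K : ℕ}
    (h : ∀ t, E (t + K) = E t) (s m : ℕ) :
    propagator E (s + K) (s + K + m) = propagator E s (s + m) := by
  induction m with
  | zero => rw [add_zero, add_zero, propagator_self, propagator_self]
  | succ m ih =>
    rw [propagator_add_succ, ih, propagator_add_succ, show s + K + m = s + m + K by ring, h]

/-- Cyclic application of trace-preserving contractions for `Tr (Xᴴ ρ⁻¹ X)`, whose norm-attaining
elements are fixed, stabilizes `ρ` as soon as `ρ` spans the common fixed points. -/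
theorem stabilizes_cyclic {K : ℕ} (hK : 0 < K) {ρ : Matrix α α ℂ} (hρ : ρ.PosDef)
    (htr : ρ.trace = 1) {F : Fin K → Matrix α α ℂ →ₗ[ℂ] Matrix α α ℂ}
    (hFtr : ∀ k X, (F k X).trace = X.trace) (hFρ : ∀ k, F k ρ = ρ)
    (hFle : ∀ k X, weight ρ (F k X) ≤ weight ρ X)
    (hFeq : ∀ k X, weight ρ X ≤ weight ρ (F k X) → F k X = X)
    (hspan : ∀ X, (∀ k, F k X = X) → X ∈ Submodule.span ℂ {ρ}) :
    Stabilizes (fun t => F ⟨t % K, Nat.mod_lt t hK⟩) ρ := by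
  set E : ℕ → Matrix α α ℂ →ₗ[ℂ] Matrix α α ℂ := fun t => F ⟨t % K, Nat.mod_lt t hK⟩ with hE
  have hper : ∀ t, E (t + K) = E t := fun t => by simp [hE]
  have hinv : ∀ s m, propagator E s (s + m) ρ = ρ :=
    propagator_apply_eq_self fun t => hFρ _
  have hanti : ∀ s X, Antitone fun m => weight ρ (propagator E s (s + m) X) := fun s X =>
    antitone_nat_of_succ_le fun m => by
      rw [propagator_add_succ]; exact hFle _ _
  have hptr : ∀ s m X, (propagator E s (s + m) X).trace = X.trace := by
    intro s m X
    induction m with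
    | zero => rw [add_zero, propagator_self]; rfl
    | succ m ih => rw [propagator_add_succ, LinearMap.comp_apply, hFtr, ih]
  have hzero : ∀ s X, X.trace = 0 → Tendsto (fun m => propagator E s (s + m) X) atTop (𝓝 0) := by
    intro s X hX
    have hstrict : ∀ Y ∈ LinearMap.ker (Matrix.traceLinearMap α ℂ ℂ), Y ≠ 0 →
        weight ρ (propagator E s (s + K) Y) < weight ρ Y := by
      intro Y hY hY0
      by_contra! hcon
      -- The weight is nonincreasing along the cycle, so equality at the end forces equality at each
      -- step, and each map in turn fixes `Y`.
      have hall : ∀ j ≤ K, propagator E s (s + j) Y = Y := by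
        intro j
        induction j with
        | zero => intro _; rw [add_zero, propagator_self]; rfl
        | succ j ih =>
          intro hj
          have h1 := ih (by omega)
          rw [propagator_add_succ, LinearMap.comp_apply, h1]
          apply hFeq
          have h2 := hanti s Y hj
          simp only [propagator_add_succ, LinearMap.comp_apply, h1] at h2
          exact hcon.trans h2
      have hfix : ∀ j < K, E (s + j) Y = Y := by
        intro j hj
        have h1 := hall (j + 1) hj
        rwa [propagator_add_succ, LinearMap.comp_apply, hall j hj.le] at h1
      have hmem := hspan Y fun k => by
        -- The offset from `s` at which the map `k` acts: `k + s (K - 1)` is congruent to `k - s`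
        -- modulo `K`, without natural subtraction of `s`.
        have h1 := hfix ((k + s * (K - 1)) % K) (Nat.mod_lt _ hK)
        have h2 : (s + (k + s * (K - 1)) % K) % K = k := by
          obtain ⟨K', rfl⟩ : ∃ K', K = K' + 1 := ⟨K - 1, by omega⟩
          rw [Nat.add_mod_mod, Nat.add_sub_cancel,
            show s + (k + s * K') = k + s * (K' + 1) by ring, Nat.add_mul_mod_self_right,
            Nat.mod_eq_of_lt k.2]
        simp only [hE, h2] at h1
        exact h1
      obtain ⟨a, rfl⟩ := Submodule.mem_span_singleton.1 hmem
      rw [LinearMap.mem_ker, Matrix.traceLinearMap_apply, Matrix.trace_smul, htr, smul_eq_mul,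
        mul_one] at hY
      exact hY0 (by rw [hY, zero_smul])
    obtain ⟨c, hc0, hc1, hc⟩ := exists_lt_one_weight_le hρ hstrict
    have hpow : ∀ m, weight ρ (propagator E s (s + m * K) X) ≤ c ^ m * weight ρ X := by
      intro m
      -- The starting matrix varies because the induction splits off the first cycle and continues
      -- from its output, which is again traceless.
      suffices H : ∀ Y : Matrix α α ℂ, Y.trace = 0 →
          weight ρ (propagator E s (s + m * K) Y) ≤ c ^ m * weight ρ Y from H X hX
      induction m with
      | zero => intro Y _; simp [propagator_self]
      | succ m ih =>
        intro Y hY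
        rw [show (m + 1) * K = K + m * K by ring, propagator_add, propagator_shift hper,
          LinearMap.comp_apply]
        refine (ih _ (by rw [hptr, hY])).trans ?_
        rw [pow_succ, mul_assoc]
        exact mul_le_mul_of_nonneg_left (hc Y hY) (pow_nonneg hc0 m)
    -- At time `m` the weight is at most that after the last completed cycle, which is number `m /
    -- K`.
    refine tendsto_zero_of_weight hρ (squeeze_zero (fun m => weight_nonneg hρ _)
      (fun m => (hanti s X (Nat.div_mul_le_self m K)).trans (hpow (m / K))) ?_)
    have h1 := (tendsto_pow_atTop_nhds_zero_of_lt_one hc0 hc1).comp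
      (Nat.tendsto_div_const_atTop hK.ne')
    simpa using h1.mul_const (weight ρ X)
  refine ⟨fun s t hst => ?_, fun τ hτ s => ?_⟩
  · obtain ⟨m, rfl⟩ := Nat.exists_eq_add_of_le hst
    exact hinv s m
  · rw [← tendsto_add_atTop_iff_nat s]
    have h1 := (hzero s (τ - ρ) (by rw [Matrix.trace_sub, hτ.2, htr, sub_self])).add_const ρ
    rw [zero_add] at h1
    refine h1.congr fun m => ?_
    rw [map_sub, hinv, sub_add_cancel, add_comm m s]

open scoped Matrix.Norms.L2Operator MatrixOrder in
theorem span_posSemidef : Submodule.span ℂ {Y : Matrix α α ℂ | Y.PosSemidef} = ⊤ := by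
  have h := CStarAlgebra.span_nonneg (A := Matrix α α ℂ)
  simpa only [Matrix.nonneg_iff_posSemidef] using h

/-- Positive-semidefinite matrices span the whole space, and each of them is zero or a positive
multiple of a density matrix, so convergence on states extends linearly. -/
theorem tendsto_trace_smul {P : ℕ → Matrix α α ℂ →ₗ[ℂ] Matrix α α ℂ} {ρ : Matrix α α ℂ}
    (h : ∀ τ, IsDensity τ → Tendsto (fun t => P t τ) atTop (𝓝 ρ)) (X : Matrix α α ℂ) :
    Tendsto (fun t => P t X) atTop (𝓝 (X.trace • ρ)) := by
  have htop : X ∈ Submodule.span ℂ {Y : Matrix α α ℂ | Y.PosSemidef} :=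
    span_posSemidef (α := α) ▸ Submodule.mem_top
  induction htop using Submodule.span_induction with
  | mem Y hY =>
    by_cases h0 : Y.trace = 0
    · rw [(Matrix.PosSemidef.trace_eq_zero_iff hY).1 h0]
      simp
    · have hd : IsDensity (Y.trace⁻¹ • Y) := by
        refine ⟨hY.smul (inv_nonneg.2 hY.trace_nonneg), ?_⟩
        rw [Matrix.trace_smul, smul_eq_mul, inv_mul_cancel₀ h0]
      refine ((h _ hd).const_smul Y.trace).congr fun t => ?_
      rw [map_smul, smul_smul, mul_inv_cancel₀ h0, one_smul]
  | zero => simp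
  | add Y Z _ _ hY hZ =>
    simpa only [map_add, Matrix.trace_add, add_smul] using hY.add hZ
  | smul c Y _ hY =>
    simpa only [map_smul, Matrix.trace_smul, smul_eq_mul, mul_smul] using hY.const_smul c

end Convergence
theorem isUnit_of_rank_eq_card {α : Type*} [Fintype α] [DecidableEq α] {A : Matrix α α ℂ}
    (hA : A.rank = Fintype.card α) : IsUnit A := by
  rw [← Matrix.mulVec_surjective_iff_isUnit]
  have h : LinearMap.range A.mulVecLin = ⊤ := by
    apply Submodule.eq_top_of_finrank_eq
    rw [Module.finrank_fintype_fun_eq_card]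
    exact hA
  exact LinearMap.range_eq_top.1 h

/-! ### Block decomposition and neighborhood maps. -/

section Neighborhoods

variable {n : ℕ} (d : Fin n → ℕ) (N : Finset (Fin n))

/-- The blocks of an operator on the whole system with respect to the complement of `N`. -/
def nbhdSlice (p : ComplConfig d N × ComplConfig d N) :
    Matrix (Config d) (Config d) ℂ →ₗ[ℂ] Matrix (NbhdConfig d N) (NbhdConfig d N) ℂ where
  toFun X := slice (asBipartite d N X) p
  map_add' _ _ := rfl
  map_smul' _ _ := rfl

theorem nbhdSlice_apply (p : ComplConfig d N × ComplConfig d N)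
    (X : Matrix (Config d) (Config d) ℂ) (a a' : NbhdConfig d N) :
    nbhdSlice d N p X a a' = X ((splitConfig d N).symm (a, p.1)) ((splitConfig d N).symm (a', p.2)) :=
  rfl

theorem nbhdSlice_nbhdTensor (p : ComplConfig d N × ComplConfig d N)
    (Y : Matrix (NbhdConfig d N) (NbhdConfig d N) ℂ)
    (Z : Matrix (ComplConfig d N) (ComplConfig d N) ℂ) :
    nbhdSlice d N p (nbhdTensor d N Y Z) = Z p.1 p.2 • Y := by
  ext a a'
  rw [nbhdSlice_apply, nbhdTensor, Matrix.submatrix_apply, Equiv.apply_symm_apply,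
    Equiv.apply_symm_apply, Matrix.kroneckerMap_apply, Matrix.smul_apply, smul_eq_mul, mul_comm]

variable {d N} in
theorem ext_nbhdSlice {X X' : Matrix (Config d) (Config d) ℂ}
    (h : ∀ p, nbhdSlice d N p X = nbhdSlice d N p X') : X = X' := by
  ext x x'
  have := congrFun (congrFun (h ((splitConfig d N x).2, (splitConfig d N x').2))
    (splitConfig d N x).1) (splitConfig d N x').1
  simpa only [nbhdSlice_apply, Prod.mk.eta, Equiv.symm_apply_apply] using this

theorem sum_nbhdTensor_nbhdSlice (X : Matrix (Config d) (Config d) ℂ) :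
    X = ∑ p, nbhdTensor d N (nbhdSlice d N p X) (Matrix.single p.1 p.2 1) := by
  refine ext_nbhdSlice (N := N) fun q => ?_
  rw [map_sum]
  simp only [nbhdSlice_nbhdTensor]
  rw [Finset.sum_eq_single q]
  · simp
  · intro p _ hp
    rw [Matrix.single_apply_of_ne, zero_smul]
    exact fun h => hp (Prod.ext h.1 h.2)
  · simp

theorem nbhdTensor_mul (Y Y' : Matrix (NbhdConfig d N) (NbhdConfig d N) ℂ)
    (Z Z' : Matrix (ComplConfig d N) (ComplConfig d N) ℂ) :
    nbhdTensor d N Y Z * nbhdTensor d N Y' Z' = nbhdTensor d N (Y * Y') (Z * Z') := by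
  rw [nbhdTensor, nbhdTensor, Matrix.submatrix_mul_equiv, ← Matrix.mul_kronecker_mul]
  rfl

theorem nbhdTensor_conjTranspose (Y : Matrix (NbhdConfig d N) (NbhdConfig d N) ℂ)
    (Z : Matrix (ComplConfig d N) (ComplConfig d N) ℂ) :
    (nbhdTensor d N Y Z)ᴴ = nbhdTensor d N Yᴴ Zᴴ := by
  rw [nbhdTensor, Matrix.conjTranspose_submatrix, Matrix.conjTranspose_kronecker]
  rfl

theorem nbhdTensor_sum_left {ι : Type*} [Fintype ι]
    (Y : ι → Matrix (NbhdConfig d N) (NbhdConfig d N) ℂ)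
    (Z : Matrix (ComplConfig d N) (ComplConfig d N) ℂ) :
    nbhdTensor d N (∑ k, Y k) Z = ∑ k, nbhdTensor d N (Y k) Z := by
  ext x x'
  simp [nbhdTensor, Matrix.sum_apply, Finset.sum_mul]

theorem nbhdTensor_smul_one (c : ℂ) : nbhdTensor d N (c • 1) 1 = c • 1 := by
  rw [nbhdTensor, Matrix.smul_kronecker, Matrix.one_kronecker_one, Matrix.submatrix_smul,
    Pi.smul_apply, Pi.smul_apply, Matrix.submatrix_one_equiv]

variable {d N}

/-- Expanding in matrix units of the complement shows that a neighborhood map acts block by block,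
which reduces its fixed points to those of the local channel. -/
theorem nbhdSlice_of_tensor {E : Matrix (Config d) (Config d) ℂ →ₗ[ℂ] Matrix (Config d) (Config d) ℂ}
    {EN : Matrix (NbhdConfig d N) (NbhdConfig d N) ℂ →ₗ[ℂ]
      Matrix (NbhdConfig d N) (NbhdConfig d N) ℂ}
    (h : ∀ Y Z, E (nbhdTensor d N Y Z) = nbhdTensor d N (EN Y) Z)
    (X : Matrix (Config d) (Config d) ℂ) (p : ComplConfig d N × ComplConfig d N) :
    nbhdSlice d N p (E X) = EN (nbhdSlice d N p X) := by
  conv_lhs => rw [sum_nbhdTensor_nbhdSlice d N X]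
  conv_rhs => rw [sum_nbhdTensor_nbhdSlice d N X]
  simp only [map_sum, h, nbhdSlice_nbhdTensor, map_smul]

theorem tensor_eq_self_iff {E : Matrix (Config d) (Config d) ℂ →ₗ[ℂ] Matrix (Config d) (Config d) ℂ}
    {EN : Matrix (NbhdConfig d N) (NbhdConfig d N) ℂ →ₗ[ℂ]
      Matrix (NbhdConfig d N) (NbhdConfig d N) ℂ}
    (h : ∀ Y Z, E (nbhdTensor d N Y Z) = nbhdTensor d N (EN Y) Z)
    (X : Matrix (Config d) (Config d) ℂ) :
    E X = X ↔ ∀ p, EN (nbhdSlice d N p X) = nbhdSlice d N p X := by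
  constructor
  · intro hX p
    rw [← nbhdSlice_of_tensor h, hX]
  · intro hX
    exact ext_nbhdSlice fun p => by rw [nbhdSlice_of_tensor h, hX]

theorem krausMap_nbhdTensor {ι : Type*} [Fintype ι]
    (M : ι → Matrix (NbhdConfig d N) (NbhdConfig d N) ℂ)
    (Y : Matrix (NbhdConfig d N) (NbhdConfig d N) ℂ)
    (Z : Matrix (ComplConfig d N) (ComplConfig d N) ℂ) :
    krausMap (fun k => nbhdTensor d N (M k) 1) (nbhdTensor d N Y Z) =
      nbhdTensor d N (krausMap M Y) Z := by
  simp only [krausMap_apply, nbhdTensor_conjTranspose, nbhdTensor_mul, Matrix.conjTranspose_one,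
    Matrix.one_mul, Matrix.mul_one, nbhdTensor_sum_left]

theorem sum_nbhdTensor_conjTranspose_mul {ι : Type*} [Fintype ι]
    {M : ι → Matrix (NbhdConfig d N) (NbhdConfig d N) ℂ} (hM : ∑ k, (M k)ᴴ * M k = 1) :
    ∑ k, (nbhdTensor d N (M k) 1)ᴴ * nbhdTensor d N (M k) 1 = 1 := by
  simp only [nbhdTensor_conjTranspose, nbhdTensor_mul, Matrix.conjTranspose_one, Matrix.mul_one,
    ← nbhdTensor_sum_left, hM]
  simpa using nbhdTensor_smul_one d N 1

variable (d N)

theorem nbhdSlice_mem_schmidtSpan (ρ : Matrix (Config d) (Config d) ℂ)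
    (p : ComplConfig d N × ComplConfig d N) :
    nbhdSlice d N p ρ ∈ schmidtSpan (asBipartite d N ρ) := by
  obtain ⟨r, P, Q, h⟩ := exists_isSchmidtDecomposition (asBipartite d N ρ)
  rw [schmidtSpan_eq h, h.span_range_eq]
  exact Submodule.subset_span ⟨p, rfl⟩

theorem schmidtSpan_asBipartite (ρ : Matrix (Config d) (Config d) ℂ) :
    schmidtSpan (asBipartite d N ρ) =
      Submodule.span ℂ (Set.range fun p => nbhdSlice d N p ρ) := by
  obtain ⟨r, P, Q, h⟩ := exists_isSchmidtDecomposition (asBipartite d N ρ)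
  rw [schmidtSpan_eq h, h.span_range_eq]
  rfl

theorem reducedState_eq_sum (ρ : Matrix (Config d) (Config d) ℂ) :
    reducedState d N ρ = ∑ b, nbhdSlice d N (b, b) ρ := by
  ext a a'
  rw [Matrix.sum_apply]
  rfl

/-- The partial trace is a sum of diagonal blocks, each a principal submatrix of `ρ`; a nonempty
complement basis makes the sum nonempty. -/
theorem posDef_reducedState {ρ : Matrix (Config d) (Config d) ℂ} (hρ : ρ.PosDef)
    [Nonempty (ComplConfig d N)] : (reducedState d N ρ).PosDef := by
  rw [reducedState_eq_sum]
  refine Matrix.posDef_sum Finset.univ_nonempty fun b _ => ?_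
  refine hρ.submatrix (e := fun a => (splitConfig d N).symm (a, b)) fun a a' h => ?_
  simpa using h

theorem reducedState_mem_schmidtSpan (ρ : Matrix (Config d) (Config d) ℂ) :
    reducedState d N ρ ∈ schmidtSpan (asBipartite d N ρ) := by
  rw [reducedState_eq_sum]
  exact Submodule.sum_mem _ fun b _ => nbhdSlice_mem_schmidtSpan d N ρ _

variable {d N}

/-- A neighborhood map that leaves a full-rank state invariant fixes its minimal fixed-point set. -/
theorem IsNeighborhoodMap.apply_eq_self
    {E : Matrix (Config d) (Config d) ℂ →ₗ[ℂ] Matrix (Config d) (Config d) ℂ}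
    (hE : IsNeighborhoodMap d N E) {ρ : Matrix (Config d) (Config d) ℂ} (hρ : ρ.PosDef)
    [Nonempty (ComplConfig d N)] (hfix : E ρ = ρ) {X : Matrix (Config d) (Config d) ℂ}
    (hX : X ∈ nbhdFixedPointSet d N ρ) : E X = X := by
  obtain ⟨EN, hEN, h⟩ := hE
  have hslice := (tensor_eq_self_iff h ρ).1 hfix
  have hspan : ∀ Y ∈ schmidtSpan (asBipartite d N ρ), EN Y = Y := by
    intro Y hY
    rw [schmidtSpan_asBipartite] at hY
    refine (Submodule.span_le.2 ?_ : _ ≤ fixedPoints EN) hY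
    rintro _ ⟨p, rfl⟩
    exact hslice p
  -- The reduced state lies in the Schmidt span, so the local channel fixes it; its fixed points are
  -- then a candidate in the minimality.
  have hmin := (isLeast_minimalFixedPointSet _ _).2
    (fixedPoints_mem_fixedPointCandidates (posDef_reducedState d N hρ) hEN
      (hspan _ (reducedState_mem_schmidtSpan d N ρ)) hspan)
  refine (Submodule.span_le.2 ?_ : nbhdFixedPointSet d N ρ ≤ fixedPoints E) hX
  rintro _ ⟨Y, hY, Z, rfl⟩
  change E _ = _
  rw [h, show EN Y = Y from hmin hY]
  rfl

theorem mem_nbhdFixedPointSet {ρ X : Matrix (Config d) (Config d) ℂ}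
    (hX : ∀ p, nbhdSlice d N p X ∈ minimalFixedPointSet (reducedState d N ρ)
      (schmidtSpan (asBipartite d N ρ) : Set (Matrix (NbhdConfig d N) (NbhdConfig d N) ℂ))) :
    X ∈ nbhdFixedPointSet d N ρ := by
  rw [sum_nbhdTensor_nbhdSlice d N X]
  exact Submodule.sum_mem _ fun p _ => Submodule.subset_span ⟨_, hX p, _, rfl⟩

theorem self_mem_nbhdFixedPointSet (ρ : Matrix (Config d) (Config d) ℂ) :
    ρ ∈ nbhdFixedPointSet d N ρ :=
  mem_nbhdFixedPointSet fun p =>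
    (isLeast_minimalFixedPointSet _ _).1.1 (nbhdSlice_mem_schmidtSpan d N ρ p)

/-- A full-rank state has an invariant neighborhood map, contracting for `Tr (Xᴴ ρ⁻¹ X)`, whose
norm-attaining elements are fixed and lie in the minimal fixed-point set. -/
theorem exists_isNeighborhoodMap {ρ : Matrix (Config d) (Config d) ℂ} (hρ : ρ.PosDef)
    [Nonempty (ComplConfig d N)] :
    ∃ E, IsNeighborhoodMap d N E ∧ E ρ = ρ ∧ (∀ X, (E X).trace = X.trace) ∧
      (∀ X, weight ρ (E X) ≤ weight ρ X) ∧ (∀ X, weight ρ X ≤ weight ρ (E X) → E X = X) ∧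
      ∀ X, E X = X → X ∈ nbhdFixedPointSet d N ρ := by
  obtain ⟨hW, hA, hmod⟩ := (isLeast_minimalFixedPointSet (reducedState d N ρ)
    (schmidtSpan (asBipartite d N ρ) : Set (Matrix (NbhdConfig d N) (NbhdConfig d N) ℂ))).1
  obtain ⟨m, M, hM, ⟨k, c, hc, hk⟩, hfix⟩ := exists_krausMap_eq_self_iff_mem
    (posDef_reducedState d N hρ) hA hmod (hW (reducedState_mem_schmidtSpan d N ρ))
  have hL := sum_nbhdTensor_conjTranspose_mul (d := d) (N := N) hM
  have hten := krausMap_nbhdTensor (d := d) (N := N) M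
  have hEρ : krausMap (fun k => nbhdTensor d N (M k) 1) ρ = ρ :=
    (tensor_eq_self_iff hten ρ).2 fun p =>
      (hfix _).2 (hW (nbhdSlice_mem_schmidtSpan d N ρ p))
  refine ⟨krausMap fun k => nbhdTensor d N (M k) 1, ⟨_, isCPTP_krausMap hM, hten⟩, hEρ,
    trace_krausMap hL, weight_krausMap_le hρ hL hEρ, fun X hX => ?_, fun X hX => ?_⟩
  · have hdet : IsUnit ρ.det := (Matrix.isUnit_iff_isUnit_det ρ).1 hρ.isUnit
    -- For the scalar Kraus operator `c • 1` the defect is `star c • ρ⁻¹ (X - E X)`, so its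
    -- vanishing gives `E X = X`.
    have h0 := defect_eq_zero hρ hL hEρ hX k
    have hc' : star c ≠ 0 := star_ne_zero.2 hc
    rw [defect, hk, nbhdTensor_smul_one, Matrix.conjTranspose_smul, Matrix.conjTranspose_one,
      Matrix.mul_smul, Matrix.mul_one, Matrix.smul_mul, Matrix.one_mul, Matrix.smul_mul,
      ← smul_sub, smul_eq_zero_iff_right hc', ← Matrix.mul_sub] at h0
    have h1 := congrArg (ρ * ·) h0
    simp only [Matrix.mul_nonsing_inv_cancel_left _ _ hdet, Matrix.mul_zero] at h1
    exact (sub_eq_zero.1 h1).symm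
  · exact mem_nbhdFixedPointSet fun p => (hfix _).1 ((tensor_eq_self_iff hten X).1 hX p)

end Neighborhoods

end QLS

/-! ### Equivalence of stabilizability and the intersection condition. -/

theorem mainTheorem4 {n : ℕ} (d : Fin n → ℕ) {K : ℕ} (hK : 0 < K)
    (N : Fin K → Finset (Fin n)) (hN : ∀ k, N k ⊂ Finset.univ)
    (ρ : Matrix (QLS.Config d) (QLS.Config d) ℂ) (hρ : QLS.IsDensity ρ)
    (hfull : ρ.rank = Fintype.card (QLS.Config d)) :
    QLS.IsQLS d N ρ ↔
      Submodule.span ℂ {ρ} = ⨅ k, QLS.nbhdFixedPointSet d (N k) ρ := by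
  have hpos : ρ.PosDef := hρ.1.posDef_iff_isUnit.2 (QLS.isUnit_of_rank_eq_card hfull)
  -- A subsystem of dimension zero would make the trace of `ρ` vanish.
  have hne : Nonempty (QLS.Config d) := by
    by_contra h
    rw [not_nonempty_iff] at h
    have := hρ.2
    simp [Matrix.trace] at this
  have hcompl : ∀ k, Nonempty (QLS.ComplConfig d (N k)) := fun k =>
    hne.map fun x => (QLS.splitConfig d (N k) x).2
  constructor
  · rintro ⟨E, hE, hinv, hconv⟩
    have hEρ : ∀ t, E t ρ = ρ := fun t => by
      have := hinv t (t + 1) (Nat.le_succ t)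
      rwa [QLS.propagator_add_succ E t 0, add_zero, QLS.propagator_self] at this
    refine le_antisymm ?_ fun X hX => ?_
    · rw [Submodule.span_le, Set.singleton_subset_iff]
      exact (Submodule.mem_iInf _).2 fun k => QLS.self_mem_nbhdFixedPointSet ρ
    · have hEX : ∀ t, E t X = X := fun t => by
        obtain ⟨k, hk⟩ := hE t
        exact hk.apply_eq_self hpos (hEρ t) ((Submodule.mem_iInf _).1 hX k)
      -- The orbit of `X` is constant and also tends to `Tr(X) ρ`, so `X` is that multiple of `ρ`.
      have h1 := QLS.tendsto_trace_smul (fun τ hτ => hconv τ hτ 0) X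
      have h2 : ∀ t, QLS.propagator E 0 t X = X := fun t => by
        have := QLS.propagator_apply_eq_self hEX 0 t
        rwa [zero_add] at this
      simp only [h2] at h1
      exact Submodule.mem_span_singleton.2 ⟨_, tendsto_nhds_unique h1 tendsto_const_nhds⟩
  · intro h
    choose F hF hFρ hFtr hFle hFeq hFmem using
      fun k => QLS.exists_isNeighborhoodMap (d := d) (N := N k) hpos
    refine ⟨_, fun t => ⟨_, hF _⟩, QLS.stabilizes_cyclic hK hpos hρ.2 hFtr hFρ hFle hFeq
      fun X hX => ?_⟩
    rw [h]
    exact (Submodule.mem_iInf _).2 fun k => hFmem k X (hX k)
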